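/- Let $X=\Lambda^2_-(\mathbb{CP}^2)$ carry the Bryant–Salamon $G_2$-structure, with metric $g=f^2g_{\mathbb R^3}+f^{-2}\pi^*g_{\mathbb{CP}^2}$ and 4-form $\psi=f^{-4}\mathrm{vol}_{\mathbb{CP}^2}-\tfrac12\varepsilon_{ijk}v^j\wedge v^k\wedge\Omega_i$. Here $f=(1+s^2)^{-1/4}$, $s$ is the Euclidean distance to the zero section along the fibres, $g_{\mathbb{CP}^2}$ is the Fubini–Study metric scaled so that the structure is torsion-free, the $\Omega_i$ are a standard local basis of the anti-self-dual 2-forms, and $v=\sum_i v^i\Omega_i$ is the covariant differential of the tautological section. Let $r=\int_0^s f(t)\,dt$ be the geodesic distance to the zero section. Identify the complement $X\setminus\mathbb{CP}^2$ of the zero section with $\mathbb R^+\times SU(3)/T^2$. For an integral weight $\alpha$ of $T^2$ let $P_\alpha=(\mathbb R^+\times SU(3))\times_{e^\alpha,T^2}SO(3)$ be the $SO(3)$-bundle over $X\setminus\mathbb{CP}^2$ induced by $T^2\xrightarrow{e^\alpha}S^1\hookrightarrow SO(3)$, with $SU(3)$ acting by left multiplication. Let $\alpha_1,\alpha_3$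 be the two positive roots of $SU(3)$ whose root spaces are not tangent to the fibres of the twistor projection $SU(3)/T^2\to\mathbb{CP}^2$. A $G_2$-monopole on (an open part of) $P_\alpha$ is a smooth pair of a connection $A$ and a section $\Phi$ of the adjoint bundle with $*(F_A\wedge\psi)=d_A\Phi$; it is irreducible if the adjoint bundle has no nonzero $A$-parallel section. For $\alpha\in\{\alpha_1,\alpha_3\}$ there is a real two-parameter family of $SU(3)$-invariant irreducible $G_2$-monopoles on $P_\alpha$, defined over sets $\{s\in S\}$ with $S\subseteq(0,\infty)$ an open interval (possibly not all of $X\setminus\mathbb{CP}^2$), with the following properties. 1. For every $\varepsilon>0$ there are members of the family defined near the level set $r=\varepsilon$, one for each pair $(x,y)$ with $x\in\mathbb R$, $y>0$. The $(x,y)$ member has at $r=\varepsilon$ the initial values $\Phi=xL_1$ and $A=\alpha+y\Lambda_\alpha$, where $L_1$ generates the maximal torus of $SO(3)$, $\alpha$ is the canonical invariant connection of $P_\alpha$, and $\Lambda_\alpha$ is the $T^2$-equivariant map that sends the root space of $\alpha$ isomorphically into $\mathfrak{so}(3)$ and vanishes on the other root spaces. Members with different $(x,y)$ are not gauge equivalent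 over $\{s\in K\}$ for any open $K$ on which both are defined and which contains the value of $s$ with $r(s)=\varepsilon$. 2. If an $SU(3)$-invariant irreducible $G_2$-monopole $(A,\Phi)$ on $P_\alpha$, in particular a member of the family, is defined on a punctured neighbourhood of the zero section, then there is $\delta>0$ such that $e^{-\delta/r^2}|\Phi|$ is unbounded on every punctured neighbourhood of the zero section. Moreover $r|\Phi|$ has no finite limit at the zero section, so that the singularity is not of Dirac type. -/

import Mathlib

open Set Filter Topology Matrix
open scoped ContDiff

attribute [local instance] Matrix.normedAddCommGroup Matrix.normedSpace

noncomputable section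

namespace BryantSalamon

/-! ## The total space of anti-self-dual 2-forms on the complex projective plane

`ℂℙ²` is the set of rank one Hermitian projectors `p` of `ℂ³`; a tangent vector at `p` is a Hermitian
matrix `u = a e* + e a*` with `e` a unit vector of the line `ℓ` of `p` and `a ⊥ e`. The bundle
`Λ²₋(ℂℙ²)` is identified with `su(ℓ^⊥)`: the matrix `ξ`, skew-Hermitian, traceless and zero on `ℓ`,
stands for the (anti-self-dual, that is primitive of type (1,1)) form `asdForm ξ` below. -/

/-- Complex `3 × 3` matrices. -/
abbrev Mat := Matrix (Fin 3) (Fin 3) ℂ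

/-- Real `3 × 3` matrices; `so(3)` is the set of skew-symmetric ones. -/
abbrev MatR := Matrix (Fin 3) (Fin 3) ℝ

/-- The group `SU(3)`. -/
def SU3 : Set Mat := {g | g ∈ Matrix.specialUnitaryGroup (Fin 3) ℂ}

/-- The Lie algebra `su(3)`. -/
def su3 : Set Mat := {X | Xᴴ = -X ∧ X.trace = 0}

/-- The maximal torus `T²` of diagonal matrices in `SU(3)`. -/
def torus : Set Mat := {t | t ∈ SU3 ∧ ∃ d : Fin 3 → ℂ, t = Matrix.diagonal d}

/-- The total space of `Λ²₋(ℂℙ²)`; the zero section is the set of the points `(p, 0)`. -/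
def LambdaMinus : Set (Mat × Mat) :=
  {x | x.1ᴴ = x.1 ∧ x.1 * x.1 = x.1 ∧ x.1.trace = 1 ∧
    x.2ᴴ = -x.2 ∧ x.2.trace = 0 ∧ x.2 * x.1 = 0}

/-- The Fubini-Study metric of `ℂℙ²`, with scalar curvature `6` (the scale for which the profile
function below gives a torsion-free `G₂`-structure). -/
def baseMetric (u v : Mat) : ℝ := 2 * (Matrix.trace (u * v)).re

/-- The Kähler form of `baseMetric` at the point `p` of `ℂℙ²`. -/
def kahlerForm (p u v : Mat) : ℝ :=
  4 * (Matrix.trace ((Complex.I • (1 - p)) * u * v)).re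

/-- The Riemannian volume form `½ ω ∧ ω` of `ℂℙ²` with its complex orientation. -/
def baseVolume (p : Mat) (u : Fin 4 → Mat) : ℝ :=
  kahlerForm p (u 0) (u 1) * kahlerForm p (u 2) (u 3)
    - kahlerForm p (u 0) (u 2) * kahlerForm p (u 1) (u 3)
    + kahlerForm p (u 0) (u 3) * kahlerForm p (u 1) (u 2)

/-- The anti-self-dual 2-form on `ℂℙ²` that corresponds to `ξ ∈ su(ℓ^⊥)`. -/
def asdForm (ξ u v : Mat) : ℝ := 8 * (Matrix.trace (ξ * u * v)).re

/-- The Euclidean metric on the fibres of `Λ²₋`. In a `baseMetric`-orthonormal coframe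
`y⁰, …, y³`, the forms `Ωᵢ = y⁰yⁱ - yʲyᵏ` are orthonormal for it. -/
def fibreMetric (a b : Mat) : ℝ := 2 * (Matrix.trace (aᴴ * b)).re

/-- The cross product of the fibres, oriented by `Ω₁, Ω₂, Ω₃`. -/
def cross (a b : Mat) : Mat := b * a - a * b

/-- The Euclidean distance `s` to the zero section along the fibres. -/
def fibreNorm (x : Mat × Mat) : ℝ := Real.sqrt (fibreMetric x.2 x.2)

/-- The vertical part `∇ξ` of a tangent vector `v = (ṗ, ξ̇)` of `Λ²₋(ℂℙ²)` at `x = (p, ξ)`, for the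
connection induced by the Levi-Civita connection of `ℂℙ²`. -/
def vertical (x v : Mat × Mat) : Mat := (1 - x.1) * v.2 * (1 - x.1)

/-- The profile function `f(s) = (1 + s²)^{-1/4}` of the Bryant-Salamon metric. -/
def profile (s : ℝ) : ℝ := (1 + s ^ 2) ^ (-(1 / 4) : ℝ)

/-- The geodesic distance `r(s)` to the zero section. -/
def radius (s : ℝ) : ℝ := ∫ t in (0 : ℝ)..s, profile t

/-- The Bryant-Salamon metric `f² g_{ℝ³} + f⁻² π* g_{ℂℙ²}`. -/
def metric (x v w : Mat × Mat) : ℝ :=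
  profile (fibreNorm x) ^ 2 * fibreMetric (vertical x v) (vertical x w)
    + (profile (fibreNorm x) ^ 2)⁻¹ * baseMetric v.1 w.1

/-- The 2-form `Ω_{a × b}` on the base, for the vertical parts `a, b` of the tangent vectors `v, w`,
evaluated at the tangent vectors `v', w'`. -/
def mixedTerm (x v w v' w' : Mat × Mat) : ℝ :=
  asdForm (cross (vertical x v) (vertical x w)) v'.1 w'.1

/-- The Bryant-Salamon 4-form `ψ = f⁻⁴ vol_{ℂℙ²} - ½ ε_{ijk} v^j ∧ v^k ∧ Ω_i`, where `v = ∇ξ`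
is the tautological vertical 1-form (the factors `f²` and `f⁻²` of the second term cancel). -/
def psi (x : Mat × Mat) (v : Fin 4 → Mat × Mat) : ℝ :=
  (profile (fibreNorm x) ^ 4)⁻¹ * baseVolume x.1 (fun i => (v i).1)
    - (mixedTerm x (v 0) (v 1) (v 2) (v 3) - mixedTerm x (v 0) (v 2) (v 1) (v 3)
      + mixedTerm x (v 0) (v 3) (v 1) (v 2) + mixedTerm x (v 1) (v 2) (v 0) (v 3)
      - mixedTerm x (v 1) (v 3) (v 0) (v 2) + mixedTerm x (v 2) (v 3) (v 0) (v 1))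

/-! ## The complement of the zero section as `ℝ⁺ × SU(3)/T²`

`SU(3)` acts by `g • (p, ξ) = (g p g*, g ξ g*)`, transitively on each sphere bundle `s = const > 0`, with
isotropy group `T²` at the base point. So `(s, g) ↦ point s g` makes `ℝ⁺ × SU(3)` a principal
`T²`-bundle over the complement of the zero section, with `T²` acting by right multiplication. -/

/-- The base point of `ℂℙ²`. -/
def basePoint : Mat := !![1, 0, 0; 0, 0, 0; 0, 0, 0]

/-- A unit vector in the fibre over `basePoint`. -/
def baseForm : Mat := !![0, 0, 0; 0, Complex.I / 2, 0; 0, 0, -(Complex.I / 2)]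

/-- The point of `Λ²₋(ℂℙ²)` with fibre distance `s` and direction `g`. -/
def point (s : ℝ) (g : Mat) : Mat × Mat :=
  (g * basePoint * gᴴ, s • (g * baseForm * gᴴ))

/-- Tangent vectors of `ℝ⁺ × SU(3)`, in the left trivialisation: `(ρ, X)` with `X ∈ su(3)` is the
velocity at `t = 0` of the curve `t ↦ (s + t ρ, g exp(t X))`. -/
abbrev Tan := ℝ × Mat

/-- The differential of `point` at `(s, g)`. -/
def pushforward (s : ℝ) (g : Mat) (V : Tan) : Mat × Mat :=
  (g * (V.2 * basePoint - basePoint * V.2) * gᴴ,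
    V.1 • (g * baseForm * gᴴ) + s • (g * (V.2 * baseForm - baseForm * V.2) * gᴴ))

/-- The pull-back of `ψ` to `ℝ⁺ × SU(3)`. -/
def psiPullback (s : ℝ) (g : Mat) (V : Fin 4 → Tan) : ℝ :=
  psi (point s g) (fun i => pushforward s g (V i))

/-- Lifts to `ℝ⁺ × SU(3)` of an oriented orthonormal frame of the Bryant-Salamon metric: the first
three vectors are vertical, the last four horizontal. -/
def frame (s : ℝ) : Fin 7 → Tan :=
  ![((profile s)⁻¹, 0),
    (0, (2 * s * profile s)⁻¹ • !![0, 0, 0; 0, 0, -Complex.I; 0, -Complex.I, 0]),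
    (0, (2 * s * profile s)⁻¹ • !![0, 0, 0; 0, 0, -1; 0, 1, 0]),
    (0, (profile s / 2) • !![0, -1, 0; 1, 0, 0; 0, 0, 0]),
    (0, (profile s / 2) • !![0, Complex.I, 0; Complex.I, 0, 0; 0, 0, 0]),
    (0, (profile s / 2) • !![0, 0, -1; 0, 0, 0; 1, 0, 0]),
    (0, (profile s / 2) • !![0, 0, Complex.I; 0, 0, 0; Complex.I, 0, 0])]

/-! ### Consistency of the model -/

theorem SU3.star_mul_self {g : Mat} (hg : g ∈ SU3) : gᴴ * g = 1 :=
  Matrix.mem_unitaryGroup_iff'.1 (Matrix.mem_specialUnitaryGroup_iff.1 hg).1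

theorem SU3.mul_star_self {g : Mat} (hg : g ∈ SU3) : g * gᴴ = 1 :=
  Matrix.mem_unitaryGroup_iff.1 (Matrix.mem_specialUnitaryGroup_iff.1 hg).1

theorem conj_mul_conj {g : Mat} (hg : g ∈ SU3) (a b : Mat) :
    (g * a * gᴴ) * (g * b * gᴴ) = g * (a * b) * gᴴ := by
  have h := SU3.star_mul_self hg
  calc (g * a * gᴴ) * (g * b * gᴴ) = g * a * (gᴴ * g) * b * gᴴ := by noncomm_ring
    _ = _ := by rw [h]; noncomm_ring

theorem trace_conj {g : Mat} (hg : g ∈ SU3) (a : Mat) :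
    Matrix.trace (g * a * gᴴ) = Matrix.trace a := by
  rw [Matrix.trace_mul_comm, ← Matrix.mul_assoc, SU3.star_mul_self hg, Matrix.one_mul]

/-- `point` takes values in the total space of `Λ²₋(ℂℙ²)`. -/
theorem point_mem (s : ℝ) {g : Mat} (hg : g ∈ SU3) : point s g ∈ LambdaMinus := by
  refine ⟨?_, ?_, ?_, ?_, ?_, ?_⟩
  · have h : basePointᴴ = basePoint := by
      ext i j; fin_cases i <;> fin_cases j <;> simp [basePoint]
    simp [point, h, Matrix.mul_assoc]
  · have h : basePoint * basePoint = basePoint := by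
      ext i j; fin_cases i <;> fin_cases j <;> simp [basePoint, Matrix.mul_apply, Fin.sum_univ_three]
    simp only [point]; rw [conj_mul_conj hg, h]
  · simp only [point]; rw [trace_conj hg]; simp [basePoint, Matrix.trace, Fin.sum_univ_three]
  · have h : baseFormᴴ = -baseForm := by
      ext i j; fin_cases i <;> fin_cases j <;> simp [baseForm, neg_div]
    simp [point, h, Matrix.mul_assoc, Matrix.conjTranspose_smul]
  · simp only [point]; rw [Matrix.trace_smul, trace_conj hg]
    simp [baseForm, Matrix.trace, Fin.sum_univ_three]
  · have h : baseForm * basePoint = 0 := by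
      ext i j; fin_cases i <;> fin_cases j <;> simp [basePoint, baseForm, Matrix.mul_apply, Fin.sum_univ_three]
    simp only [point]; rw [Matrix.smul_mul, conj_mul_conj hg, h]; simp

theorem fibreNorm_point {s : ℝ} (hs : 0 ≤ s) {g : Mat} (hg : g ∈ SU3) :
    fibreNorm (point s g) = s := by
  have h : fibreMetric (point s g).2 (point s g).2 = s ^ 2 := by
    have h1 : (s • (g * baseForm * gᴴ))ᴴ * (s • (g * baseForm * gᴴ))
        = (s * s) • (g * (baseFormᴴ * baseForm) * gᴴ) := by
      rw [← conj_mul_conj hg]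
      simp [Matrix.conjTranspose_smul, smul_smul, Matrix.mul_assoc]
    simp only [fibreMetric, point]
    have h2 : Matrix.trace (baseFormᴴ * baseForm) = ((1 / 2 : ℝ) : ℂ) := by
      simp [baseForm, Matrix.trace, Matrix.mul_apply, Fin.sum_univ_three]
      ring_nf
      simp [Complex.conj_ofNat]
    rw [h1, Matrix.trace_smul, trace_conj hg, h2, Complex.real_smul, ← Complex.ofReal_mul,
      Complex.ofReal_re]
    ring
  rw [fibreNorm, h, Real.sqrt_sq hs]

theorem hasDerivAt_conj_exp {R : Type*} [NormedRing R] [NormedAlgebra ℝ R] [CompleteSpace R]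
    (g h X B : R) :
    HasDerivAt (fun t : ℝ => g * NormedSpace.exp (t • X) * B * (NormedSpace.exp (t • -X) * h))
      (g * (X * B - B * X) * h) 0 := by
  have hE : ∀ Y : R, HasDerivAt (fun t : ℝ => NormedSpace.exp (t • Y)) Y 0 := by
    intro Y
    have := hasDerivAt_exp_smul_const (𝕂 := ℝ) Y (0 : ℝ)
    simpa using this
  refine ((((hE X).const_mul g).mul_const B).mul ((hE (-X)).mul_const h)).congr_deriv ?_
  simp
  noncomm_ring

/-- `pushforward` is the differential of `point`. -/
theorem hasDerivAt_point (s : ℝ) (g : Mat) (V : Tan) (hV : V.2 ∈ su3) :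
    HasDerivAt (fun t : ℝ => point (s + t * V.1) (g * NormedSpace.exp (t • V.2)))
      (pushforward s g V) 0 := by
  have hEs : ∀ t : ℝ, (NormedSpace.exp (t • V.2))ᴴ = NormedSpace.exp (t • -V.2) := by
    intro t
    rw [← Matrix.exp_conjTranspose, Matrix.conjTranspose_smul, hV.1, star_trivial]
  have key : ∀ B : Mat, HasDerivAt
      (fun t : ℝ => g * NormedSpace.exp (t • V.2) * B * (g * NormedSpace.exp (t • V.2))ᴴ)
      (g * (V.2 * B - B * V.2) * gᴴ) 0 := by
    intro B
    simp only [Matrix.conjTranspose_mul, hEs]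
    exact @hasDerivAt_conj_exp Mat Matrix.linftyOpNormedRing Matrix.linftyOpNormedAlgebra
      (inferInstanceAs (CompleteSpace (Fin 3 → Fin 3 → ℂ))) g gᴴ V.2 B
  have hs : HasDerivAt (fun t : ℝ => s + t * V.1) V.1 0 := by
    simpa using ((hasDerivAt_id (0 : ℝ)).mul_const V.1).const_add s
  refine (key basePoint).prodMk ?_
  refine (hs.smul (key baseForm)).congr_deriv ?_
  simp [add_comm]

theorem profile_pos (s : ℝ) : 0 < profile s := Real.rpow_pos_of_pos (by positivity) _

/-- `frame` is orthonormal for the Bryant-Salamon metric. -/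
theorem frame_orthonormal {s : ℝ} (hs : 0 < s) {g : Mat} (hg : g ∈ SU3) (i j : Fin 7) :
    metric (point s g) (pushforward s g (frame s i)) (pushforward s g (frame s j))
      = if i = j then 1 else 0 := by
  have hv : ∀ V : Tan, vertical (point s g) (pushforward s g V) =
      g * ((1 - basePoint) * (V.1 • baseForm + s • (V.2 * baseForm - baseForm * V.2))
        * (1 - basePoint)) * gᴴ := by
    intro V
    have h1 : (1 : Mat) - g * basePoint * gᴴ = g * (1 - basePoint) * gᴴ := by
      rw [Matrix.mul_sub, Matrix.sub_mul, Matrix.mul_one, SU3.mul_star_self hg]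
    have h2 : V.1 • (g * baseForm * gᴴ) + s • (g * (V.2 * baseForm - baseForm * V.2) * gᴴ)
        = g * (V.1 • baseForm + s • (V.2 * baseForm - baseForm * V.2)) * gᴴ := by
      simp [Matrix.mul_add, Matrix.add_mul]
    simp only [vertical, point, pushforward]
    rw [h1, h2, conj_mul_conj hg, conj_mul_conj hg]
  have hm : ∀ V W : Tan, metric (point s g) (pushforward s g V) (pushforward s g W) =
      profile s ^ 2 * fibreMetric
        ((1 - basePoint) * (V.1 • baseForm + s • (V.2 * baseForm - baseForm * V.2))
          * (1 - basePoint))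
        ((1 - basePoint) * (W.1 • baseForm + s • (W.2 * baseForm - baseForm * W.2))
          * (1 - basePoint)) +
      (profile s ^ 2)⁻¹ * baseMetric (V.2 * basePoint - basePoint * V.2)
        (W.2 * basePoint - basePoint * W.2) := by
    intro V W
    simp only [metric, fibreNorm_point hs.le hg, hv]
    simp only [fibreMetric, baseMetric, pushforward]
    rw [conj_mul_conj hg, trace_conj hg]
    have hc : ∀ a b : Mat, (g * a * gᴴ)ᴴ * (g * b * gᴴ) = g * (aᴴ * b) * gᴴ := by
      intro a b
      rw [← conj_mul_conj hg]
      simp [Matrix.mul_assoc]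
    rw [hc, trace_conj hg]
  have hf := (profile_pos s).ne'
  have hs' := hs.ne'
  have hp : (1 : Mat) - basePoint = !![0, 0, 0; 0, 1, 0; 0, 0, 1] := by
    ext i j; fin_cases i <;> fin_cases j <;> simp [basePoint]
  have hF : ∀ V W : Tan, metric (point s g) (pushforward s g V) (pushforward s g W) =
      profile s ^ 2 * (V.1 * W.1 + 2 * s ^ 2 * ((V.2 1 2).re * (W.2 1 2).re
        + (V.2 1 2).im * (W.2 1 2).im + (V.2 2 1).re * (W.2 2 1).re
        + (V.2 2 1).im * (W.2 2 1).im)) -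
      (profile s ^ 2)⁻¹ * (2 * (V.2 0 1 * W.2 1 0 + V.2 0 2 * W.2 2 0 + V.2 1 0 * W.2 0 1
        + V.2 2 0 * W.2 0 2).re) := by
    intro V W
    have hV : ∀ V : Tan, !![0, 0, 0; 0, 1, 0; 0, 0, 1] *
        (V.1 • baseForm + s • (V.2 * baseForm - baseForm * V.2)) *
        !![0, 0, 0; 0, 1, 0; 0, 0, 1] =
        (!![0, 0, 0; 0, V.1 * Complex.I / 2, -(Complex.I * s * V.2 1 2);
          0, Complex.I * s * V.2 2 1, -(V.1 * Complex.I / 2)] : Mat) := by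
      intro V
      ext i j
      simp only [Matrix.mul_apply, Matrix.sub_apply, Matrix.add_apply, Matrix.smul_apply,
        Fin.sum_univ_three]
      fin_cases i <;> fin_cases j <;> simp [baseForm] <;> ring
    have hB : ∀ V : Tan, V.2 * basePoint - basePoint * V.2 =
        (!![0, -V.2 0 1, -V.2 0 2; V.2 1 0, 0, 0; V.2 2 0, 0, 0] : Mat) := by
      intro V
      ext i j
      simp only [Matrix.mul_apply, Matrix.sub_apply, Fin.sum_univ_three]
      fin_cases i <;> fin_cases j <;> simp [basePoint]
    rw [hm, hp, hV, hV, hB, hB]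
    simp only [fibreMetric, baseMetric, Matrix.trace, Matrix.mul_apply, Fin.sum_univ_three,
      Matrix.diag_apply, Matrix.conjTranspose_apply]
    simp
    ring
  rw [hF]
  simp only [frame]
  generalize profile s = F at hf
  fin_cases i <;> fin_cases j <;> simp <;> field_simp <;> norm_num

/-! ## Forms on the complement of the zero section with values in the adjoint bundle -/

/-- Derivative of a function on `ℝ⁺ × SU(3)` along the left-invariant vector field `V`. -/
def dirDeriv (f : ℝ → Mat → MatR) (s : ℝ) (g : Mat) (V : Tan) : MatR :=
  deriv (fun t : ℝ => f (s + t * V.1) (g * NormedSpace.exp (t • V.2))) 0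

/-- Smoothness of a function on the submanifold `S × SU(3)`, `S ⊆ ℝ⁺` open. -/
def SmoothOver (S : Set ℝ) (f : ℝ → Mat → MatR) : Prop :=
  ContDiffOn ℝ ∞ (fun x : ℝ × Mat => f x.1 x.2) (S ×ˢ SU3)

/-- The wedge product of a matrix-valued 2-form and a real 4-form. -/
def wedge (F : Tan → Tan → MatR) (η : (Fin 4 → Tan) → ℝ) (v : Fin 6 → Tan) : MatR :=
  ∑ j : Fin 6, ∑ i : Fin 5,
    if i.castSucc < j then
      ((-1 : ℝ) ^ ((i : ℕ) + (j : ℕ) + 1) * η (fun m => v (j.succAbove (i.succAbove m)))) •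
        F (v i.castSucc) (v j)
    else 0

/-- The `k`-th component of the Hodge dual of a matrix-valued 6-form, with respect to an oriented
orthonormal frame `E` of a 7-dimensional space. -/
def hodgeStar (E : Fin 7 → Tan) (η : (Fin 6 → Tan) → MatR) (k : Fin 7) : MatR :=
  (-1 : ℝ) ^ (k : ℕ) • η (fun m => E (k.succAbove m))

/-- The generators of `so(3)`: `[L₁, L₂] = L₃` and cyclically. -/
def L₁ : MatR := !![0, 0, 0; 0, 0, -1; 0, 1, 0]

/-- See `L₁`. -/
def L₂ : MatR := !![0, 0, 1; 0, 0, 0; -1, 0, 0]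

/-- See `L₁`. -/
def L₃ : MatR := !![0, -1, 0; 1, 0, 0; 0, 0, 0]

/-- The norm of an `Ad`-invariant inner product on `so(3)` (with `L₁, L₂, L₃` orthonormal). -/
def soNorm (B : MatR) : ℝ := Real.sqrt (Matrix.trace (Bᵀ * B) / 2)

/-- The embedding of the circle in `SO(3)` as the maximal torus. -/
def rotation (z : ℂ) : MatR := !![1, 0, 0; 0, z.re, -z.im; 0, z.im, z.re]

/-- The homomorphism `T² → S¹ → SO(3)` given by the integral weight
`α = α 0 · ε₀ + α 1 · ε₁ + α 2 · ε₂`. -/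
def weightHom (α : Fin 3 → ℤ) (t : Mat) : MatR := rotation (∏ i, t i i ^ α i)

/-- The canonical invariant connection: `α`, extended by zero on the root spaces, with values in the
Lie algebra of the maximal torus of `SO(3)`. -/
def canonicalConnection (α : Fin 3 → ℤ) (X : Mat) : MatR := (∑ i, (α i : ℝ) * (X i i).im) • L₁

/-- The root `ε_i - ε_j` of `SU(3)`. The positive roots are `α₁ = root 0 1`, `α₂ = root 1 2`,
`α₃ = root 0 2`; `α₂` is the one whose root space is tangent to the fibres of the twistor
projection. -/
def root (i j : Fin 3) : Fin 3 → ℤ := Pi.single i 1 - Pi.single j 1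

/-- The morphism of `T²`-representations `𝔪 → so(3)` for `α = root i j`: an isomorphism from the root
space of `α` to the span of `L₂, L₃`, zero on the other root spaces and on the diagonal. -/
def rootMorphism (i j : Fin 3) (X : Mat) : MatR := (X i j).re • L₂ + (X i j).im • L₃

/-- Left-trivialised matrix-valued 1-forms on (a part of) `ℝ⁺ × SU(3)`. -/
abbrev OneForm := ℝ → Mat → (Tan →ₗ[ℝ] MatR)

/-- `A` is a smooth connection over `{s ∈ S}` on the `SO(3)`-bundle
`P_α = (ℝ⁺ × SU(3)) ×_{e^α, T²} SO(3)`, given by its pull-back to `ℝ⁺ × SU(3)`: an `so(3)`-valued 1-form,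
equivariant under the right action of `T²`, and equal to `α` on the vertical vectors of this action.
(Only the values on vectors `(ρ, X)` with `X ∈ su(3)`, at points of `S × SU(3)`, have a meaning.) -/
structure IsConnection (α : Fin 3 → ℤ) (S : Set ℝ) (A : OneForm) : Prop where
  smooth : ∀ V : Tan, SmoothOver S (fun s g => A s g V)
  skew : ∀ s ∈ S, ∀ g ∈ SU3, ∀ V : Tan, V.2 ∈ su3 → (A s g V)ᵀ = -A s g V
  equivariant : ∀ s ∈ S, ∀ g ∈ SU3, ∀ t ∈ torus, ∀ V : Tan, V.2 ∈ su3 →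
    A s (g * t) (V.1, tᴴ * V.2 * t) = (weightHom α t)ᵀ * A s g V * weightHom α t
  vertical : ∀ s ∈ S, ∀ g ∈ SU3, ∀ d : Fin 3 → ℂ, Matrix.diagonal d ∈ su3 →
    A s g (0, Matrix.diagonal d) = canonicalConnection α (Matrix.diagonal d)

/-- `Φ` is a smooth section over `{s ∈ S}` of the adjoint bundle of `P_α` (a Higgs field), given as a
`T²`-equivariant function on `S × SU(3)`. -/
structure IsSection (α : Fin 3 → ℤ) (S : Set ℝ) (Φ : ℝ → Mat → MatR) : Prop where
  smooth : SmoothOver S Φ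
  skew : ∀ s ∈ S, ∀ g ∈ SU3, (Φ s g)ᵀ = -Φ s g
  equivariant : ∀ s ∈ S, ∀ g ∈ SU3, ∀ t ∈ torus,
    Φ s (g * t) = (weightHom α t)ᵀ * Φ s g * weightHom α t

/-- The curvature `F_A = dA + ½ [A ∧ A]`, evaluated on left-invariant vector fields (whose bracket is
`[(ρ, X), (σ, Y)] = (0, X Y - Y X)`). -/
def curvature (A : OneForm) (s : ℝ) (g : Mat) (V W : Tan) : MatR :=
  dirDeriv (fun s g => A s g W) s g V - dirDeriv (fun s g => A s g V) s g W
    - A s g (0, V.2 * W.2 - W.2 * V.2) + (A s g V * A s g W - A s g W * A s g V)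

/-- The covariant derivative `d_A Φ`. -/
def covDeriv (A : OneForm) (Φ : ℝ → Mat → MatR) (s : ℝ) (g : Mat) (V : Tan) : MatR :=
  dirDeriv Φ s g V + (A s g V * Φ s g - Φ s g * A s g V)

/-- The `G₂`-monopole equation `*(F_A ∧ ψ) = d_A Φ` over `{s ∈ S}`. Both sides are pull-backs from the
7-manifold, hence determined by their values on the frame. -/
def IsMonopole (S : Set ℝ) (A : OneForm) (Φ : ℝ → Mat → MatR) : Prop :=
  ∀ s ∈ S, ∀ g ∈ SU3, ∀ k : Fin 7,
    hodgeStar (frame s) (wedge (curvature A s g) (psiPullback s g)) k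
      = covDeriv A Φ s g (frame s k)

/-- Invariance of `(A, Φ)` under the action of `SU(3)` on `P_α` by left multiplication. -/
def IsInvariant (S : Set ℝ) (A : OneForm) (Φ : ℝ → Mat → MatR) : Prop :=
  ∀ s ∈ S, ∀ h ∈ SU3, ∀ g ∈ SU3,
    (∀ V : Tan, V.2 ∈ su3 → A s (h * g) V = A s g V) ∧ Φ s (h * g) = Φ s g

/-- Irreducibility: no nonzero section of the adjoint bundle is parallel. (As the group is `SO(3)` and
the base `{s ∈ S}`, `S` an interval, is simply connected, this says that the holonomy group of `A` is
the whole of `SO(3)`.) -/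
def IsIrreducible (α : Fin 3 → ℤ) (S : Set ℝ) (A : OneForm) : Prop :=
  ∀ η : ℝ → Mat → MatR, IsSection α S η →
    (∀ s ∈ S, ∀ g ∈ SU3, ∀ V : Tan, V.2 ∈ su3 → covDeriv A η s g V = 0) →
    ∀ s ∈ S, ∀ g ∈ SU3, η s g = 0

/-- `(A, Φ)` is an `SU(3)`-invariant irreducible `G₂`-monopole on `P_α`, defined on the part `{s ∈ S}` of
the complement of the zero section, where `S ⊆ ℝ⁺` is a nonempty open interval. -/
structure IsInvariantIrreducibleMonopole (α : Fin 3 → ℤ) (S : Set ℝ) (A : OneForm)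
    (Φ : ℝ → Mat → MatR) : Prop where
  isOpen : IsOpen S
  ordConnected : S.OrdConnected
  nonempty : S.Nonempty
  pos : S ⊆ Ioi 0
  connection : IsConnection α S A
  higgs : IsSection α S Φ
  monopole : IsMonopole S A Φ
  invariant : IsInvariant S A Φ
  irreducible : IsIrreducible α S A

/-- Gauge equivalence over `{s ∈ S}` of pairs of a connection and a Higgs field on `P_α`; a gauge
transformation is a smooth `T²`-equivariant function `u : S × SU(3) → SO(3)`. -/
def GaugeEquivalent (α : Fin 3 → ℤ) (S : Set ℝ) (A : OneForm) (Φ : ℝ → Mat → MatR)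
    (A' : OneForm) (Φ' : ℝ → Mat → MatR) : Prop :=
  ∃ u : ℝ → Mat → MatR, SmoothOver S u ∧
    ∀ s ∈ S, ∀ g ∈ SU3,
      u s g ∈ Matrix.specialOrthogonalGroup (Fin 3) ℝ ∧
      (∀ t ∈ torus, u s (g * t) = (weightHom α t)ᵀ * u s g * weightHom α t) ∧
      Φ' s g = u s g * Φ s g * (u s g)ᵀ ∧
      ∀ V : Tan, V.2 ∈ su3 →
        A' s g V = u s g * A s g V * (u s g)ᵀ - dirDeriv u s g V * (u s g)ᵀ

end BryantSalamon

end

open BryantSalamon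

namespace BryantSalamon

/-! ## The group `SU(3)` -/

/-! An invariant pair is determined, for each `s`, by its value at the identity of `SU(3)`, where
the connection is a torus-equivariant linear map into `so(3)`. The torus acts on the three root
spaces through different characters, so equivariance leaves only `A = q ds + α + (b + i d) Λ_α` and
`Φ = φ L₁` (`exists_isInvariantForm`). In the orthonormal frame the 4-form `ψ` has constant integer
components (`psiPullback_frame`). Writing `F` for the profile and `σ = ±1` for `higgsSign`, the
monopole equation for such pairs becomes (`monopole_iff_of_invariant`) `σ φ' = 1/(2 s² F) - F³/2 +
F³ (b² + d²)/4`, `(b + i d)' = (σ F φ - 1/s - i q)(b + i d)`.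

Existence: with `q = d = 0` this is a smooth planar system, solvable near `s₀` for all initial
values `(b, φ) = (y, x)` (`exists_local_solution`). If `b` never vanishes the connection is
irreducible: a parallel section is constant along the two root spaces on which `A` vanishes, hence
along their bracket, which is the root space of `α`; so it commutes with `L₂` and `L₃` and is zero
(`isIrreducible_of_invariant`).

Inequivalence: a gauge transformation preserves `|Φ|` and `|[A, Φ]|`, that is `φ²` and `(b φ)²`
(`sq_eq_of_gaugeEquivalent`). As `b > 0`, the differential equations recover `b` and `φ` from these,
also where `φ` vanishes (`initial_values_eq_of_gaugeEquivalent`).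

Growth: put `ψ = σ φ` and `W = s² (b² + d²)`. Then `W' = 2 F ψ W`, and `ψ' ≥ (8 + W)/(32 s²)` near
`s = 0`. Irreducibility makes `W` nonzero at one point, and the linear equation then makes it
positive everywhere. As `s` decreases to zero, `ψ` tends to minus infinity, which makes `W` grow,
which in turn makes `ψ` fall faster. Finitely many rounds of this feedback give `ψ ≤ K - exp (1/s²)`
(`eventually_le_sub_exp`). Since `s/2 ≤ r ≤ s` near the zero section, this beats both `exp (1/(8
r²))` and `1/r`. -/

theorem SU3.mul_mem {g h : Mat} (hg : g ∈ SU3) (hh : h ∈ SU3) : g * h ∈ SU3 :=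
  (Matrix.specialUnitaryGroup (Fin 3) ℂ).mul_mem hg hh

theorem SU3.one_mem : (1 : Mat) ∈ SU3 := (Matrix.specialUnitaryGroup (Fin 3) ℂ).one_mem

theorem SU3.conjTranspose_mem {g : Mat} (hg : g ∈ SU3) : gᴴ ∈ SU3 :=
  Matrix.mem_specialUnitaryGroup_iff.2 ⟨Matrix.mem_unitaryGroup_iff.2 (by
    simpa [Matrix.star_eq_conjTranspose] using SU3.star_mul_self hg), by
    rw [Matrix.det_conjTranspose, (Matrix.mem_specialUnitaryGroup_iff.1 hg).2, star_one]⟩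

theorem su3.smul_mem {X : Mat} (hX : X ∈ su3) (t : ℝ) : t • X ∈ su3 :=
  ⟨by rw [Matrix.conjTranspose_smul, hX.1, star_trivial, smul_neg], by
    rw [Matrix.trace_smul, hX.2, smul_zero]⟩

theorem su3.zero_mem : (0 : Mat) ∈ su3 := ⟨by simp, by simp⟩

theorem su3.bracket_mem {X Y : Mat} (hX : X ∈ su3) (hY : Y ∈ su3) : X * Y - Y * X ∈ su3 :=
  ⟨by simp [Matrix.conjTranspose_mul, hX.1, hY.1], by
    rw [Matrix.trace_sub, Matrix.trace_mul_comm, sub_self]⟩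

theorem conjTranspose_exp_smul {X : Mat} (hX : X ∈ su3) (t : ℝ) :
    (NormedSpace.exp (t • X))ᴴ = NormedSpace.exp (t • -X) := by
  rw [← Matrix.exp_conjTranspose, Matrix.conjTranspose_smul, hX.1, star_trivial]

/-- Unitarity is `exp(X)* = exp(-X)`. For the determinant, the Hermitian matrix `-iX` is
diagonalised by a unitary matrix, and the product of the exponentials of the eigenvalues of `X` is
the exponential of the trace. -/
theorem exp_mem_SU3 {X : Mat} (hX : X ∈ su3) : NormedSpace.exp X ∈ SU3 := by
  refine Matrix.mem_specialUnitaryGroup_iff.2 ⟨Matrix.mem_unitaryGroup_iff.2 ?_, ?_⟩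
  · rw [Matrix.star_eq_conjTranspose, ← Matrix.exp_conjTranspose, hX.1, Matrix.exp_neg]
    exact Matrix.mul_nonsing_inv _ ((Matrix.isUnit_iff_isUnit_det _).1 (Matrix.isUnit_exp X))
  · have hH : (-(Complex.I • X) : Mat).IsHermitian := by
      rw [Matrix.IsHermitian, Matrix.conjTranspose_neg, Matrix.conjTranspose_smul, hX.1]
      simp
    set U : Mat := hH.eigenvectorUnitary.1 with hU
    have hUU : U * star U = 1 := Matrix.mem_unitaryGroup_iff.1 hH.eigenvectorUnitary.2
    have hUi : U⁻¹ = star U := Matrix.inv_eq_right_inv hUU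
    have hUu : IsUnit U := by
      rw [Matrix.isUnit_iff_isUnit_det]
      exact Matrix.isUnit_det_of_right_inverse hUU
    have hspec : X = U * Matrix.diagonal (fun i => Complex.I * (hH.eigenvalues i : ℂ)) * U⁻¹ := by
      have h := hH.spectral_theorem
      have h1 : X = Complex.I • (-(Complex.I • X)) := by
        rw [smul_neg, smul_smul, Complex.I_mul_I, neg_smul, one_smul, neg_neg]
      refine (h1.trans (congrArg (Complex.I • ·) h)).trans ?_
      rw [hUi, Unitary.conjStarAlgAut_apply]
      have : Matrix.diagonal (fun i => Complex.I * (hH.eigenvalues i : ℂ))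
          = Complex.I • Matrix.diagonal (RCLike.ofReal ∘ hH.eigenvalues) := by
        rw [← Matrix.diagonal_smul]; rfl
      rw [this, Matrix.mul_smul, Matrix.smul_mul]
    have htr : ∑ i, Complex.I * (hH.eigenvalues i : ℂ) = 0 := by
      have h := hX.2
      rw [hspec, Matrix.trace_mul_comm, ← Matrix.mul_assoc, Matrix.nonsing_inv_mul _
        ((Matrix.isUnit_iff_isUnit_det _).1 hUu), Matrix.one_mul, Matrix.trace_diagonal] at h
      exact h
    rw [hspec, Matrix.exp_conj _ _ hUu, Matrix.det_conj hUu, Matrix.exp_diagonal,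
      Matrix.det_diagonal]
    have : ∀ i, NormedSpace.exp (fun i => Complex.I * (hH.eigenvalues i : ℂ)) i
        = Complex.exp (Complex.I * (hH.eigenvalues i : ℂ)) := by
      intro i
      rw [Pi.coe_exp, Complex.exp_eq_exp_ℂ]
    rw [Finset.prod_congr rfl (fun i _ => this i), ← Complex.exp_sum, htr, Complex.exp_zero]

theorem hasDerivAt_mul_exp (g X : Mat) :
    HasDerivAt (fun t : ℝ => g * NormedSpace.exp (t • X)) (g * X) 0 := by
  -- The entrywise norm on matrices is not submultiplicative. The derivative of the exponential is
  -- therefore taken in an abstract normed algebra and then read for the operator norm, which has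
  -- the same topology.
  have key : ∀ {R : Type} [NormedRing R] [NormedAlgebra ℝ R] [CompleteSpace R] (g X : R),
      HasDerivAt (fun t : ℝ => g * NormedSpace.exp (t • X)) (g * X) 0 := by
    intro R _ _ _ g X
    have := (hasDerivAt_exp_smul_const (𝕂 := ℝ) X (0 : ℝ)).const_mul g
    simpa using this
  exact @key Mat Matrix.linftyOpNormedRing Matrix.linftyOpNormedAlgebra
      (inferInstanceAs (CompleteSpace (Fin 3 → Fin 3 → ℂ))) g X

theorem hasDerivAt_conj_exp_smul (g X B : Mat) (hX : X ∈ su3) :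
    HasDerivAt (fun t : ℝ => g * (NormedSpace.exp (t • X) * B * (NormedSpace.exp (t • X))ᴴ))
      (g * (X * B - B * X)) 0 := by
  have := @hasDerivAt_conj_exp Mat Matrix.linftyOpNormedRing Matrix.linftyOpNormedAlgebra
      (inferInstanceAs (CompleteSpace (Fin 3 → Fin 3 → ℂ))) g 1 X B
  simp only [mul_one, mul_assoc] at this
  simp only [conjTranspose_exp_smul hX, mul_assoc]
  exact this

theorem su3.conj_mem {X : Mat} (hX : X ∈ su3) {g : Mat} (hg : g ∈ SU3) : g * X * gᴴ ∈ su3 :=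
  ⟨by simp [Matrix.conjTranspose_mul, hX.1, Matrix.mul_assoc], by rw [trace_conj hg, hX.2]⟩

/-! ## The Lie algebra `so(3)` -/

/-- The element `a L₁ + b L₂ + d L₃` of `so(3)`. -/
def hat (a b d : ℝ) : MatR := !![0, -d, b; d, 0, -a; -b, a, 0]

theorem hat_eq (a b d : ℝ) : hat a b d = a • L₁ + b • L₂ + d • L₃ := by
  ext i j; fin_cases i <;> fin_cases j <;> simp [hat, L₁, L₂, L₃]

theorem hat_inj {a b d a' b' d' : ℝ} :
    hat a b d = hat a' b' d' ↔ a = a' ∧ b = b' ∧ d = d' := by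
  refine ⟨fun h => ⟨?_, ?_, ?_⟩, fun ⟨h1, h2, h3⟩ => by rw [h1, h2, h3]⟩
  · simpa [hat] using congrFun (congrFun h 2) 1
  · simpa [hat] using congrFun (congrFun h 0) 2
  · simpa [hat] using congrFun (congrFun h 1) 0

theorem hat_zero : hat 0 0 0 = 0 := by
  ext i j; fin_cases i <;> fin_cases j <;> simp [hat]

theorem smul_hat (t a b d : ℝ) : t • hat a b d = hat (t * a) (t * b) (t * d) := by
  ext i j; fin_cases i <;> fin_cases j <;> simp [hat]

theorem hat_add (a b d a' b' d' : ℝ) :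
    hat a b d + hat a' b' d' = hat (a + a') (b + b') (d + d') := by
  ext i j; fin_cases i <;> fin_cases j <;> simp [hat] <;> ring

theorem neg_hat (a b d : ℝ) : -hat a b d = hat (-a) (-b) (-d) := by
  ext i j; fin_cases i <;> fin_cases j <;> simp [hat]

theorem hat_sub (a b d a' b' d' : ℝ) :
    hat a b d - hat a' b' d' = hat (a - a') (b - b') (d - d') := by
  ext i j; fin_cases i <;> fin_cases j <;> simp [hat] <;> ring

theorem hat_bracket (a b d a' b' d' : ℝ) :
    hat a b d * hat a' b' d' - hat a' b' d' * hat a b d =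
      hat (b * d' - d * b') (d * a' - a * d') (a * b' - b * a') := by
  ext i j
  simp only [Matrix.sub_apply, Matrix.mul_apply, Fin.sum_univ_three]
  fin_cases i <;> fin_cases j <;> simp [hat] <;> ring

theorem transpose_hat (a b d : ℝ) : (hat a b d)ᵀ = -hat a b d := by
  ext i j; fin_cases i <;> fin_cases j <;> simp [hat]

theorem trace_transpose_hat_mul_self (a b d : ℝ) :
    Matrix.trace ((hat a b d)ᵀ * hat a b d) = 2 * (a ^ 2 + b ^ 2 + d ^ 2) := by
  simp only [Matrix.trace, Matrix.diag_apply, Matrix.mul_apply, Fin.sum_univ_three,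
    Matrix.transpose_apply]
  simp [hat]; ring

theorem exists_eq_hat {B : MatR} (hB : Bᵀ = -B) : B = hat (B 2 1) (B 0 2) (B 1 0) := by
  have h : ∀ i j, B j i = -B i j := fun i j => congrFun (congrFun hB i) j
  ext i j
  fin_cases i <;> fin_cases j <;> simp [hat]
  · linarith [h 0 0]
  · exact h 1 0
  · linarith [h 1 1]
  · exact h 2 1
  · exact h 0 2
  · linarith [h 2 2]

/-- On the plane of `L₂, L₃`, read as the complex numbers `b + i d`, conjugation is multiplication
by the conjugate of `z`; the axis `L₁` is fixed. -/
theorem rotation_conj_hat (z : ℂ) (hz : z.re ^ 2 + z.im ^ 2 = 1) (a b d : ℝ) :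
    (rotation z)ᵀ * hat a b d * rotation z =
      hat a (z.re * b + z.im * d) (z.re * d - z.im * b) := by
  have h : z.re ^ 2 = 1 - z.im ^ 2 := by linarith
  ext i j
  simp only [Matrix.mul_apply, Fin.sum_univ_three, Matrix.transpose_apply]
  fin_cases i <;> fin_cases j <;> simp [hat, rotation] <;> ring_nf <;> simp [h] <;> ring


/-! ## The 4-form in the standard frame -/

/-- The horizontal part of `pushforward s 1 V`. -/
noncomputable def horPart (V : Tan) : Mat := V.2 * basePoint - basePoint * V.2

/-- The vertical part of `pushforward s 1 V`. -/
noncomputable def verPart (s : ℝ) (V : Tan) : Mat :=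
  (1 - basePoint) * (V.1 • baseForm + s • (V.2 * baseForm - baseForm * V.2)) * (1 - basePoint)

theorem vertical_pushforward (s : ℝ) {g : Mat} (hg : g ∈ SU3) (V : Tan) :
    vertical (point s g) (pushforward s g V) = g * verPart s V * gᴴ := by
  have h1 : (1 : Mat) - g * basePoint * gᴴ = g * (1 - basePoint) * gᴴ := by
    rw [Matrix.mul_sub, Matrix.sub_mul, Matrix.mul_one, SU3.mul_star_self hg]
  have h2 : V.1 • (g * baseForm * gᴴ) + s • (g * (V.2 * baseForm - baseForm * V.2) * gᴴ)
      = g * (V.1 • baseForm + s • (V.2 * baseForm - baseForm * V.2)) * gᴴ := by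
    simp [Matrix.mul_add, Matrix.add_mul]
  simp only [vertical, point, pushforward, verPart]
  rw [h1, h2, conj_mul_conj hg, conj_mul_conj hg]

theorem kahlerForm_conj {g : Mat} (hg : g ∈ SU3) (p u v : Mat) :
    kahlerForm (g * p * gᴴ) (g * u * gᴴ) (g * v * gᴴ) = kahlerForm p u v := by
  have h1 : Complex.I • ((1 : Mat) - g * p * gᴴ) = g * (Complex.I • (1 - p)) * gᴴ := by
    rw [Matrix.mul_smul, Matrix.smul_mul, Matrix.mul_sub, Matrix.sub_mul, Matrix.mul_one,
      SU3.mul_star_self hg]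
  rw [kahlerForm, h1, conj_mul_conj hg, conj_mul_conj hg, trace_conj hg, kahlerForm]

theorem asdForm_conj {g : Mat} (hg : g ∈ SU3) (ξ u v : Mat) :
    asdForm (g * ξ * gᴴ) (g * u * gᴴ) (g * v * gᴴ) = asdForm ξ u v := by
  rw [asdForm, conj_mul_conj hg, conj_mul_conj hg, trace_conj hg, asdForm]

theorem cross_conj {g : Mat} (hg : g ∈ SU3) (a b : Mat) :
    cross (g * a * gᴴ) (g * b * gᴴ) = g * cross a b * gᴴ := by
  rw [cross, conj_mul_conj hg, conj_mul_conj hg, cross, Matrix.mul_sub, Matrix.sub_mul]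

/-- A 4-form of the shape of `psi`, in terms of the bilinear forms `κ` and the 4-linear form `μ`. -/
def psiShape {ι R : Type*} [Ring R] (c : R) (κ : ι → ι → R) (μ : ι → ι → ι → ι → R)
    (v : Fin 4 → ι) : R :=
  c * (κ (v 0) (v 1) * κ (v 2) (v 3) - κ (v 0) (v 2) * κ (v 1) (v 3)
      + κ (v 0) (v 3) * κ (v 1) (v 2))
    - (μ (v 0) (v 1) (v 2) (v 3) - μ (v 0) (v 2) (v 1) (v 3) + μ (v 0) (v 3) (v 1) (v 2)
      + μ (v 1) (v 2) (v 0) (v 3) - μ (v 1) (v 3) (v 0) (v 2) + μ (v 2) (v 3) (v 0) (v 1))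

/-- All ingredients of `ψ` are traces of products, hence unchanged by conjugation with `g`; only the
base point has to be examined. -/
theorem psiPullback_eq {s : ℝ} (hs : 0 ≤ s) {g : Mat} (hg : g ∈ SU3) (V : Fin 4 → Tan) :
    psiPullback s g V = psiShape (profile s ^ 4)⁻¹
      (fun V W => kahlerForm basePoint (horPart V) (horPart W))
      (fun V W V' W' => asdForm (cross (verPart s V) (verPart s W)) (horPart V') (horPart W')) V := by
  have h1 : ∀ V : Tan, (pushforward s g V).1 = g * horPart V * gᴴ := fun V => rfl
  have h2 : (point s g).1 = g * basePoint * gᴴ := rfl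
  simp only [psiPullback, psi, fibreNorm_point hs hg, baseVolume, mixedTerm,
    vertical_pushforward s hg, cross_conj hg, h1, h2, asdForm_conj hg, kahlerForm_conj hg, psiShape]

/-- The first coordinates of the horizontal parts of the frame vectors, for `profile s = 1`. -/
noncomputable def frameFst : Fin 7 → ℂ := ![0, 0, 0, 1 / 2, Complex.I / 2, 0, 0]

/-- The second coordinates of the horizontal parts of the frame vectors, for `profile s = 1`. -/
noncomputable def frameSnd : Fin 7 → ℂ := ![0, 0, 0, 0, 0, 1 / 2, Complex.I / 2]

/-- The horizontal parts of the frame vectors, for `profile s = 1`. -/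
noncomputable def frameHor (i : Fin 7) : Mat :=
  !![0, star (frameFst i), star (frameSnd i); frameFst i, 0, 0; frameSnd i, 0, 0]

/-- An oriented orthonormal basis of the fibre of `Λ²₋` over the base point. -/
noncomputable def fibreBasis : Fin 3 → Mat :=
  ![baseForm, !![0, 0, 0; 0, 0, -1 / 2; 0, 1 / 2, 0],
    !![0, 0, 0; 0, 0, Complex.I / 2; 0, Complex.I / 2, 0]]

/-- The vertical parts of the frame vectors, for `profile s = 1`. -/
noncomputable def frameVer : Fin 7 → Mat := ![fibreBasis 0, fibreBasis 1, fibreBasis 2, 0, 0, 0, 0]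

theorem horPart_frame (s : ℝ) (i : Fin 7) : horPart (frame s i) = profile s • frameHor i := by
  have h : ∀ X : Mat, X * basePoint - basePoint * X =
      !![0, -X 0 1, -X 0 2; X 1 0, 0, 0; X 2 0, 0, 0] := by
    intro X
    ext i j
    simp only [Matrix.mul_apply, Matrix.sub_apply, Fin.sum_univ_three]
    fin_cases i <;> fin_cases j <;> simp [basePoint]
  rw [horPart, h]
  ext a b
  fin_cases i <;> fin_cases a <;> fin_cases b <;> simp [frame, frameHor, frameFst, frameSnd] <;> ring

theorem verPart_frame {s : ℝ} (hs : 0 < s) (i : Fin 7) :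
    verPart s (frame s i) = (profile s)⁻¹ • frameVer i := by
  have hp : (1 : Mat) - basePoint = !![0, 0, 0; 0, 1, 0; 0, 0, 1] := by
    ext i j; fin_cases i <;> fin_cases j <;> simp [basePoint]
  have hV : ∀ V : Tan, !![0, 0, 0; 0, 1, 0; 0, 0, 1] *
      (V.1 • baseForm + s • (V.2 * baseForm - baseForm * V.2)) *
      !![0, 0, 0; 0, 1, 0; 0, 0, 1] =
      (!![0, 0, 0; 0, V.1 * Complex.I / 2, -(Complex.I * s * V.2 1 2);
        0, Complex.I * s * V.2 2 1, -(V.1 * Complex.I / 2)] : Mat) := by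
    intro V
    ext i j
    simp only [Matrix.mul_apply, Matrix.sub_apply, Matrix.add_apply, Matrix.smul_apply,
      Fin.sum_univ_three]
    fin_cases i <;> fin_cases j <;> simp [baseForm] <;> ring
  have hs' : (s : ℂ) ≠ 0 := by exact_mod_cast hs.ne'
  have hf : (profile s : ℂ) ≠ 0 := by exact_mod_cast (profile_pos s).ne'
  rw [verPart, hp, hV]
  ext a b
  fin_cases i <;> fin_cases a <;> fin_cases b <;>
    simp [frame, frameVer, fibreBasis, baseForm] <;> field_simp <;> simp

/-- The components of the Kähler form in the standard frame. -/
def kahlerCoeff (i j : Fin 7) : ℤ :=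
  if (i = 3 ∧ j = 4) ∨ (i = 5 ∧ j = 6) then 1
  else if (i = 4 ∧ j = 3) ∨ (i = 6 ∧ j = 5) then -1 else 0

/-- The structure constants of the cross product of vertical vectors in the standard frame. -/
def crossCoeff (i j : Fin 7) (m : Fin 3) : ℤ :=
  if (i = 0 ∧ j = 1 ∧ m = 2) ∨ (i = 1 ∧ j = 2 ∧ m = 0) ∨ (i = 2 ∧ j = 0 ∧ m = 1) then 1
  else if (i = 1 ∧ j = 0 ∧ m = 2) ∨ (i = 2 ∧ j = 1 ∧ m = 0) ∨ (i = 0 ∧ j = 2 ∧ m = 1) then -1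
  else 0

/-- The components of the forms `Ω₁, Ω₂, Ω₃` in the standard frame. -/
def asdCoeff (m : Fin 3) (i j : Fin 7) : ℤ :=
  if (m = 0 ∧ ((i = 3 ∧ j = 4) ∨ (i = 6 ∧ j = 5))) ∨ (m = 1 ∧ ((i = 3 ∧ j = 5) ∨ (i = 4 ∧ j = 6)))
    ∨ (m = 2 ∧ ((i = 3 ∧ j = 6) ∨ (i = 5 ∧ j = 4))) then 1
  else if (m = 0 ∧ ((i = 4 ∧ j = 3) ∨ (i = 5 ∧ j = 6)))
    ∨ (m = 1 ∧ ((i = 5 ∧ j = 3) ∨ (i = 6 ∧ j = 4)))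
    ∨ (m = 2 ∧ ((i = 6 ∧ j = 3) ∨ (i = 4 ∧ j = 5))) then -1
  else 0

theorem kahlerForm_frameHor (i j : Fin 7) :
    kahlerForm basePoint (frameHor i) (frameHor j) = kahlerCoeff i j := by
  have hp : (1 : Mat) - basePoint = !![0, 0, 0; 0, 1, 0; 0, 0, 1] := by
    ext i j; fin_cases i <;> fin_cases j <;> simp [basePoint]
  have h : kahlerForm basePoint (frameHor i) (frameHor j) =
      -(4 * (frameFst i * star (frameFst j) + frameSnd i * star (frameSnd j)).im) := by
    simp only [kahlerForm, hp, Matrix.trace, Matrix.diag_apply, Matrix.mul_apply,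
      Fin.sum_univ_three, Matrix.smul_apply]
    simp [frameHor]
    ring
  rw [h]
  fin_cases i <;> fin_cases j <;> simp [frameFst, frameSnd, kahlerCoeff] <;> norm_num

theorem cross_frameVer (i j : Fin 7) :
    cross (frameVer i) (frameVer j) = ∑ m, (crossCoeff i j m : ℝ) • fibreBasis m := by
  rw [Fin.sum_univ_three]
  fin_cases i <;> fin_cases j <;> simp [frameVer, crossCoeff, cross] <;>
  · ext a b
    simp only [Matrix.sub_apply, Matrix.mul_apply, Fin.sum_univ_three]
    fin_cases a <;> fin_cases b <;> simp [fibreBasis, baseForm] <;> ring_nf <;> simp <;> norm_num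

theorem asdForm_frameHor (m : Fin 3) (i j : Fin 7) :
    asdForm (fibreBasis m) (frameHor i) (frameHor j) = asdCoeff m i j := by
  have h : ∀ x y z w : ℂ,
      asdForm !![0, 0, 0; 0, x, y; 0, z, w] (frameHor i) (frameHor j) =
      8 * (x * (frameFst i * star (frameFst j)) + y * (frameSnd i * star (frameFst j)) +
        z * (frameFst i * star (frameSnd j)) + w * (frameSnd i * star (frameSnd j))).re := by
    intro x y z w
    simp only [asdForm, Matrix.trace, Matrix.diag_apply, Matrix.mul_apply, Fin.sum_univ_three]
    simp [frameHor]
    ring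
  fin_cases m <;> simp only [fibreBasis, baseForm] <;>
  [have := h (Complex.I / 2) 0 0 (-(Complex.I / 2)); have := h 0 (-1 / 2) (1 / 2) 0;
    have := h 0 (Complex.I / 2) (Complex.I / 2) 0] <;>
  refine this.trans ?_ <;>
  fin_cases i <;> fin_cases j <;> simp [frameFst, frameSnd, asdCoeff] <;> norm_num

/-- The components of `psi` in the standard frame. -/
def psiCoeff : (Fin 4 → Fin 7) → ℤ :=
  psiShape 1 kahlerCoeff (fun i j k l => ∑ m, crossCoeff i j m * asdCoeff m k l)

/-- Horizontal frame vectors carry a factor `F` and vertical ones `F⁻¹`. These cancel the `F⁻⁴` of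
the volume term and each other in the mixed terms, which leaves integers independent of `s` and `g`.
-/
theorem psiPullback_frame {s : ℝ} (hs : 0 < s) {g : Mat} (hg : g ∈ SU3) (e : Fin 4 → Fin 7) :
    psiPullback s g (fun m => frame s (e m)) = psiCoeff e := by
  have hf := (profile_pos s).ne'
  have hκ : ∀ i j, kahlerForm basePoint (horPart (frame s i)) (horPart (frame s j)) =
      profile s ^ 2 * kahlerCoeff i j := by
    intro i j
    rw [horPart_frame, horPart_frame, ← kahlerForm_frameHor]
    simp only [kahlerForm, Matrix.mul_smul, Matrix.smul_mul, Matrix.trace_smul, Complex.smul_re,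
      smul_eq_mul]
    ring
  have hμ : ∀ i j k l, asdForm (cross (verPart s (frame s i)) (verPart s (frame s j)))
      (horPart (frame s k)) (horPart (frame s l)) =
      ((∑ m, crossCoeff i j m * asdCoeff m k l : ℤ) : ℝ) := by
    intro i j k l
    have h1 : cross (verPart s (frame s i)) (verPart s (frame s j)) =
        (profile s ^ 2)⁻¹ • ∑ m, (crossCoeff i j m : ℝ) • fibreBasis m := by
      rw [verPart_frame hs, verPart_frame hs, ← cross_frameVer]
      simp only [cross, Matrix.mul_smul, Matrix.smul_mul, smul_smul, smul_sub]
      congr 2 <;> field_simp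
    rw [h1, horPart_frame, horPart_frame]
    push_cast
    simp only [← asdForm_frameHor]
    simp only [asdForm, Matrix.mul_smul, Matrix.smul_mul, Matrix.trace_smul, Complex.smul_re,
      smul_eq_mul, Finset.sum_mul, Matrix.trace_sum, Complex.re_sum, Finset.mul_sum]
    refine Finset.sum_congr rfl fun m _ => ?_
    field_simp
  rw [psiPullback_eq hs.le hg, psiCoeff]
  simp only [psiShape, hκ, hμ]
  push_cast
  field_simp


/-- Each component of the dual of `G ∧ ψ` is a sum over pairs of frame vectors in which only three
coefficients are nonzero. As the coefficients are integers, the hypothesis `h` is decidable. -/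
theorem sum_smul_of_three_terms {ι κ : Type*} [Fintype ι] [Fintype κ] [DecidableEq ι]
    [DecidableEq κ] {M : Type*} [AddCommGroup M] [Module ℝ M] (c : ι → κ → ℤ) (H : ι → κ → M)
    (j₁ : ι) (i₁ : κ) (e₁ : ℤ) (j₂ : ι) (i₂ : κ) (e₂ : ℤ) (j₃ : ι) (i₃ : κ) (e₃ : ℤ)
    (h : ∀ j i, c j i = (if j = j₁ ∧ i = i₁ then e₁ else 0) + (if j = j₂ ∧ i = i₂ then e₂ else 0)
      + (if j = j₃ ∧ i = i₃ then e₃ else 0)) :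
    ∑ j, ∑ i, (c j i : ℝ) • H j i =
      (e₁ : ℝ) • H j₁ i₁ + (e₂ : ℝ) • H j₂ i₂ + (e₃ : ℝ) • H j₃ i₃ := by
  simp only [h]
  push_cast
  simp only [add_smul, Finset.sum_add_distrib, ite_and, ite_smul, zero_smul,
    Finset.sum_ite_irrel, Finset.sum_const_zero, Finset.sum_ite_eq', Finset.mem_univ, if_true]

theorem hodgeStar_wedge_psiPullback {s : ℝ} (hs : 0 < s) {g : Mat} (hg : g ∈ SU3)
    (G : Tan → Tan → MatR) (k : Fin 7) :
    hodgeStar (frame s) (wedge G (psiPullback s g)) k = (-1 : ℝ) ^ (k : ℕ) •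
      ∑ j : Fin 6, ∑ i : Fin 5, ((if i.castSucc < j then
        (-1) ^ ((i : ℕ) + (j : ℕ) + 1) *
          psiCoeff (fun m => k.succAbove (j.succAbove (i.succAbove m))) else 0 : ℤ) : ℝ) •
        G (frame s (k.succAbove i.castSucc)) (frame s (k.succAbove j)) := by
  simp only [hodgeStar, wedge]
  congr 1
  refine Finset.sum_congr rfl fun j _ => Finset.sum_congr rfl fun i _ => ?_
  rw [psiPullback_frame hs hg (fun m => k.succAbove (j.succAbove (i.succAbove m)))]
  split_ifs <;> simp

/-- The Hodge dual of `G ∧ ψ` in the standard frame. -/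
theorem hodgeStar_wedge_frame {s : ℝ} (hs : 0 < s) {g : Mat} (hg : g ∈ SU3)
    (G : Tan → Tan → MatR) :
    hodgeStar (frame s) (wedge G (psiPullback s g)) 0 =
      G (frame s 1) (frame s 2) + G (frame s 3) (frame s 4) - G (frame s 5) (frame s 6) ∧
    hodgeStar (frame s) (wedge G (psiPullback s g)) 1 =
      -G (frame s 0) (frame s 2) + G (frame s 3) (frame s 5) + G (frame s 4) (frame s 6) ∧
    hodgeStar (frame s) (wedge G (psiPullback s g)) 2 =
      G (frame s 0) (frame s 1) - G (frame s 4) (frame s 5) + G (frame s 3) (frame s 6) ∧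
    hodgeStar (frame s) (wedge G (psiPullback s g)) 3 =
      -G (frame s 0) (frame s 4) - G (frame s 1) (frame s 5) - G (frame s 2) (frame s 6) ∧
    hodgeStar (frame s) (wedge G (psiPullback s g)) 4 =
      G (frame s 0) (frame s 3) + G (frame s 2) (frame s 5) - G (frame s 1) (frame s 6) ∧
    hodgeStar (frame s) (wedge G (psiPullback s g)) 5 =
      G (frame s 1) (frame s 3) - G (frame s 2) (frame s 4) + G (frame s 0) (frame s 6) ∧
    hodgeStar (frame s) (wedge G (psiPullback s g)) 6 =
      G (frame s 2) (frame s 3) + G (frame s 1) (frame s 4) - G (frame s 0) (frame s 5) := by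
  refine ⟨?_, ?_, ?_, ?_, ?_, ?_, ?_⟩
  -- The numbers are the positions `(j, i)` of the three surviving terms, each followed by its
  -- coefficient; likewise in the other six components.
  · rw [hodgeStar_wedge_psiPullback hs hg, sum_smul_of_three_terms _ _ 1 0 (1) 3 2 (1) 5 4 (-1) (by decide +kernel)]
    norm_num [Fin.succAbove]
    try abel
  · rw [hodgeStar_wedge_psiPullback hs hg, sum_smul_of_three_terms _ _ 1 0 (1) 4 2 (-1) 5 3 (-1) (by decide +kernel)]
    norm_num [Fin.succAbove]
    try abel
  · rw [hodgeStar_wedge_psiPullback hs hg, sum_smul_of_three_terms _ _ 1 0 (1) 4 3 (-1) 5 2 (1) (by decide +kernel)]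
    norm_num [Fin.succAbove]
    try abel
  · rw [hodgeStar_wedge_psiPullback hs hg, sum_smul_of_three_terms _ _ 3 0 (1) 4 1 (1) 5 2 (1) (by decide +kernel)]
    norm_num [Fin.succAbove]
    try abel
  · rw [hodgeStar_wedge_psiPullback hs hg, sum_smul_of_three_terms _ _ 3 0 (1) 4 2 (1) 5 1 (-1) (by decide +kernel)]
    norm_num [Fin.succAbove]
    try abel
  · rw [hodgeStar_wedge_psiPullback hs hg, sum_smul_of_three_terms _ _ 3 1 (-1) 4 2 (1) 5 0 (-1) (by decide +kernel)]
    norm_num [Fin.succAbove]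
    try abel
  · rw [hodgeStar_wedge_psiPullback hs hg, sum_smul_of_three_terms _ _ 3 2 (1) 4 1 (1) 5 0 (-1) (by decide +kernel)]
    norm_num [Fin.succAbove]
    try abel


/-! ## Invariant connections and Higgs fields -/

theorem HasDerivAt.hat {a b d : ℝ → ℝ} {a' b' d' t : ℝ} (ha : HasDerivAt a a' t)
    (hb : HasDerivAt b b' t) (hd : HasDerivAt d d' t) :
    HasDerivAt (fun t => hat (a t) (b t) (d t)) (hat a' b' d') t := by
  simp only [hat_eq]
  exact ((ha.smul_const L₁).add (hb.smul_const L₂)).add (hd.smul_const L₃)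

/-- The value on `V` of the invariant connection `q ds + α + (b + i d) Λ_α`, `α = root 0 k`. -/
noncomputable def connValue (k : Fin 3) (q b d : ℝ) (V : Tan) : MatR :=
  hat ((V.2 0 0).im - (V.2 k k).im + V.1 * q) (b * (V.2 0 k).re - d * (V.2 0 k).im)
    (b * (V.2 0 k).im + d * (V.2 0 k).re)

/-- On `{s ∈ S}`, the pair `(A, Φ)` is the invariant one given by the functions `q, b, d` and `φ`. -/
structure IsInvariantForm (k : Fin 3) (S : Set ℝ) (q b d φ : ℝ → ℝ) (A : OneForm)
    (Φ : ℝ → Mat → MatR) : Prop where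
  conn : ∀ s ∈ S, ∀ g ∈ SU3, ∀ V : Tan, V.2 ∈ su3 → A s g V = connValue k (q s) (b s) (d s) V
  higgs : ∀ s ∈ S, ∀ g ∈ SU3, Φ s g = hat (φ s) 0 0

theorem eventually_add_mul_mem {S : Set ℝ} (hS : IsOpen S) {s : ℝ} (hs : s ∈ S) (ρ : ℝ) :
    ∀ᶠ t in 𝓝 (0 : ℝ), s + t * ρ ∈ S := by
  have h : Tendsto (fun t : ℝ => s + t * ρ) (𝓝 0) (𝓝 (s + 0 * ρ)) :=
    (continuous_const.add (continuous_id.mul continuous_const)).tendsto 0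
  rw [zero_mul, add_zero] at h
  exact h.eventually (hS.mem_nhds hs)

theorem mul_exp_mem_SU3 {g X : Mat} (hg : g ∈ SU3) (hX : X ∈ su3) (t : ℝ) :
    g * NormedSpace.exp (t • X) ∈ SU3 :=
  SU3.mul_mem hg (exp_mem_SU3 (su3.smul_mem hX t))

theorem hasDerivAt_add_mul (s ρ : ℝ) : HasDerivAt (fun t : ℝ => s + t * ρ) ρ 0 := by
  simpa using ((hasDerivAt_id (0 : ℝ)).mul_const ρ).const_add s

/-- The derivative of an invariant function. -/
theorem dirDeriv_of_invariant {S : Set ℝ} (hS : IsOpen S) {f : ℝ → Mat → MatR} {F : ℝ → MatR}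
    (hf : ∀ s ∈ S, ∀ g ∈ SU3, f s g = F s) {s : ℝ} (hs : s ∈ S) {F' : MatR}
    (hF : HasDerivAt F F' s) {g : Mat} (hg : g ∈ SU3) {V : Tan} (hV : V.2 ∈ su3) :
    dirDeriv f s g V = V.1 • F' := by
  refine HasDerivAt.deriv ?_
  have h1 : HasDerivAt (fun t : ℝ => F (s + t * V.1)) (V.1 • F') 0 := by
    have hF' : HasDerivAt F F' (s + 0 * V.1) := by rw [zero_mul, add_zero]; exact hF
    exact hF'.scomp (0 : ℝ) (hasDerivAt_add_mul s V.1)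
  refine h1.congr_of_eventuallyEq ?_
  filter_upwards [eventually_add_mul_mem hS hs V.1] with t ht
  exact hf _ ht _ (mul_exp_mem_SU3 hg hV t)

theorem hasDerivAt_connValue (k : Fin 3) {q b d : ℝ → ℝ} {q' b' d' s : ℝ} (hq : HasDerivAt q q' s)
    (hb : HasDerivAt b b' s) (hd : HasDerivAt d d' s) (V : Tan) :
    HasDerivAt (fun s => connValue k (q s) (b s) (d s) V)
      (hat (V.1 * q') (b' * (V.2 0 k).re - d' * (V.2 0 k).im)
        (b' * (V.2 0 k).im + d' * (V.2 0 k).re)) s := by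
  refine HasDerivAt.hat ((hq.const_mul V.1).const_add _) ?_ ?_
  · exact (hb.mul_const _).sub (hd.mul_const _)
  · exact (hb.mul_const _).add (hd.mul_const _)

theorem curvature_of_invariant {k : Fin 3} {S : Set ℝ} (hS : IsOpen S) {q b d φ : ℝ → ℝ}
    {A : OneForm} {Φ : ℝ → Mat → MatR} (hA : IsInvariantForm k S q b d φ A Φ) {s : ℝ} (hs : s ∈ S)
    {q' b' d' : ℝ} (hq : HasDerivAt q q' s) (hb : HasDerivAt b b' s) (hd : HasDerivAt d d' s)
    {g : Mat} (hg : g ∈ SU3) {V W : Tan} (hV : V.2 ∈ su3) (hW : W.2 ∈ su3) :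
    curvature A s g V W =
      V.1 • hat (W.1 * q') (b' * (W.2 0 k).re - d' * (W.2 0 k).im)
        (b' * (W.2 0 k).im + d' * (W.2 0 k).re)
      - W.1 • hat (V.1 * q') (b' * (V.2 0 k).re - d' * (V.2 0 k).im)
        (b' * (V.2 0 k).im + d' * (V.2 0 k).re)
      - connValue k (q s) (b s) (d s) (0, V.2 * W.2 - W.2 * V.2)
      + (connValue k (q s) (b s) (d s) V * connValue k (q s) (b s) (d s) W
        - connValue k (q s) (b s) (d s) W * connValue k (q s) (b s) (d s) V) := by
  rw [curvature, dirDeriv_of_invariant hS (fun s hs g hg => hA.conn s hs g hg W hW) hs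
      (hasDerivAt_connValue k hq hb hd W) hg hV,
    dirDeriv_of_invariant hS (fun s hs g hg => hA.conn s hs g hg V hV) hs
      (hasDerivAt_connValue k hq hb hd V) hg hW, hA.conn s hs g hg V hV, hA.conn s hs g hg W hW,
    hA.conn s hs g hg _ (su3.bracket_mem hV hW)]

theorem covDeriv_of_invariant {k : Fin 3} {S : Set ℝ} (hS : IsOpen S) {q b d φ : ℝ → ℝ}
    {A : OneForm} {Φ : ℝ → Mat → MatR} (hA : IsInvariantForm k S q b d φ A Φ) {s : ℝ} (hs : s ∈ S)
    {φ' : ℝ} (hφ : HasDerivAt φ φ' s) {g : Mat} (hg : g ∈ SU3) {V : Tan} (hV : V.2 ∈ su3) :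
    covDeriv A Φ s g V = hat (V.1 * φ')
      (φ s * (b s * (V.2 0 k).im + d s * (V.2 0 k).re))
      (-(φ s * (b s * (V.2 0 k).re - d s * (V.2 0 k).im))) := by
  rw [covDeriv, dirDeriv_of_invariant hS (fun s hs g hg => hA.higgs s hs g hg) hs
    (HasDerivAt.hat hφ (hasDerivAt_const s (0 : ℝ)) (hasDerivAt_const s (0 : ℝ))) hg hV,
    hA.conn s hs g hg V hV, hA.higgs s hs g hg, connValue, hat_bracket, smul_hat, hat_add]
  congr 1 <;> ring


/-! ### The monopole equation as a system of ordinary differential equations -/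

theorem frame_mem (s : ℝ) (i : Fin 7) : (frame s i).2 ∈ su3 := by
  refine ⟨?_, ?_⟩
  · ext a b
    rw [Matrix.conjTranspose_apply]
    fin_cases i <;> fin_cases a <;> fin_cases b <;> simp [frame]
  · fin_cases i <;> simp [frame, Matrix.trace, Fin.sum_univ_three]

/-- The sign by which the Higgs fields on the two bundles differ. -/
noncomputable def higgsSign (k : Fin 3) : ℝ := if k = 1 then -1 else 1

/-- The `G₂`-monopole equation for invariant pairs is a system of ordinary differential equations. -/
theorem monopole_iff_of_invariant {k : Fin 3} (hk : k = 1 ∨ k = 2) {S : Set ℝ} (hS : IsOpen S)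
    {q b d φ : ℝ → ℝ} {A : OneForm} {Φ : ℝ → Mat → MatR} (hA : IsInvariantForm k S q b d φ A Φ)
    {s : ℝ} (hs : s ∈ S) (hs0 : 0 < s) {q' b' d' φ' : ℝ} (hq : HasDerivAt q q' s)
    (hb : HasDerivAt b b' s) (hd : HasDerivAt d d' s) (hφ : HasDerivAt φ φ' s) {g : Mat}
    (hg : g ∈ SU3) :
    (∀ i : Fin 7, hodgeStar (frame s) (wedge (curvature A s g) (psiPullback s g)) i
      = covDeriv A Φ s g (frame s i)) ↔
    higgsSign k * φ' = 1 / (2 * s ^ 2 * profile s) - profile s ^ 3 / 2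
        + profile s ^ 3 * (b s ^ 2 + d s ^ 2) / 4 ∧
      b' = q s * d s + (higgsSign k * profile s * φ s - 1 / s) * b s ∧
      d' = -(q s * b s) + (higgsSign k * profile s * φ s - 1 / s) * d s := by
  obtain ⟨h0, h1, h2, h3, h4, h5, h6⟩ := hodgeStar_wedge_frame hs0 hg (curvature A s g)
  have hF := profile_pos s
  have hc : ∀ i, covDeriv A Φ s g (frame s i) = _ := fun i =>
    covDeriv_of_invariant hS hA hs hφ hg (frame_mem s i)
  have hG : ∀ i j, curvature A s g (frame s i) (frame s j) = _ := fun i j =>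
    curvature_of_invariant hS hA hs hq hb hd hg (frame_mem s i) (frame_mem s j)
  have e0 : frame s 0 = ((profile s)⁻¹, 0) := rfl
  have e1 : frame s 1 =
    (0, (2 * s * profile s)⁻¹ • !![0, 0, 0; 0, 0, -Complex.I; 0, -Complex.I, 0]) := rfl
  have e2 : frame s 2 = (0, (2 * s * profile s)⁻¹ • !![0, 0, 0; 0, 0, -1; 0, 1, 0]) := rfl
  have e3 : frame s 3 = (0, (profile s / 2) • !![0, -1, 0; 1, 0, 0; 0, 0, 0]) := rfl
  have e4 : frame s 4 = (0, (profile s / 2) • !![0, Complex.I, 0; Complex.I, 0, 0; 0, 0, 0]) := rfl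
  have e5 : frame s 5 = (0, (profile s / 2) • !![0, 0, -1; 0, 0, 0; 1, 0, 0]) := rfl
  have e6 : frame s 6 = (0, (profile s / 2) • !![0, 0, Complex.I; 0, 0, 0; Complex.I, 0, 0]) := rfl
  have hall : ∀ {X Y : Fin 7 → MatR}, (∀ i, X i = Y i) ↔ X 0 = Y 0 ∧ X 1 = Y 1 ∧ X 2 = Y 2 ∧
      X 3 = Y 3 ∧ X 4 = Y 4 ∧ X 5 = Y 5 ∧ X 6 = Y 6 := by
    intro X Y
    refine ⟨fun h => ⟨h 0, h 1, h 2, h 3, h 4, h 5, h 6⟩, ?_⟩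
    rintro ⟨a0, a1, a2, a3, a4, a5, a6⟩ i
    fin_cases i <;> assumption
  rw [hall, h0, h1, h2, h3, h4, h5, h6]
  simp only [hG, hc]
  simp only [connValue, hat_bracket, hat_add, hat_sub, smul_hat, neg_hat, hat_inj,
    Matrix.sub_apply, Matrix.mul_apply, Fin.sum_univ_three]
  rw [e0, e1, e2, e3, e4, e5, e6]
  generalize profile s = F at *
  clear hG hc h0 h1 h2 h3 h4 h5 h6 hall e0 e1 e2 e3 e4 e5 e6
  have hF0 := hF.ne'
  have hs1 := hs0.ne'
  -- The planes of frame vectors 3, 4 and 5, 6 are the root spaces of `α₁` and `α₃`. They enter the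
  -- radial component with opposite signs, and the two roots also take opposite values on the
  -- bracket of frame vectors 1 and 2; this is the origin of `higgsSign`.
  rcases hk with rfl | rfl
  · simp [higgsSign]
    constructor
    · rintro ⟨h0, -, h3, h4⟩
      refine ⟨?_, ?_, ?_⟩
      · field_simp at h0 ⊢
        linarith
      · field_simp at h3 ⊢
        linarith
      · field_simp at h4 ⊢
        linarith
    · rintro ⟨h0, h1, h2⟩
      obtain rfl : φ' = -(F⁻¹ * ((s ^ 2)⁻¹ * 2⁻¹) - F ^ 3 / 2 + F ^ 3 * (b s ^ 2 + d s ^ 2) / 4) := by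
        linarith
      subst h1 h2
      refine ⟨?_, ⟨?_, ?_⟩, ?_, ?_⟩ <;> field_simp <;> ring
  · simp [higgsSign]
    constructor
    · rintro ⟨h0, -, h3, h4⟩
      refine ⟨?_, ?_, ?_⟩
      · field_simp at h0 ⊢
        linarith
      · field_simp at h3 ⊢
        linarith
      · field_simp at h4 ⊢
        linarith
    · rintro ⟨h0, h1, h2⟩
      subst h0 h1 h2
      refine ⟨?_, ⟨?_, ?_⟩, ?_, ?_⟩ <;> field_simp <;> ring


/-! ## Classification of invariant connections and Higgs fields -/

theorem diagonal_mem_torus {d : Fin 3 → ℂ} (hd : ∀ i, d i * star (d i) = 1)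
    (hp : d 0 * d 1 * d 2 = 1) : Matrix.diagonal d ∈ torus := by
  refine ⟨Matrix.mem_specialUnitaryGroup_iff.2 ⟨Matrix.mem_unitaryGroup_iff.2 ?_, ?_⟩, d, rfl⟩
  · rw [Matrix.star_eq_conjTranspose, Matrix.diagonal_conjTranspose, Matrix.diagonal_mul_diagonal,
      ← Matrix.diagonal_one]
    congr 1
    exact funext hd
  · rw [Matrix.det_diagonal, Fin.prod_univ_three, hp]

theorem weightHom_diagonal {k : Fin 3} (hk : k = 1 ∨ k = 2) (d : Fin 3 → ℂ) :
    weightHom (root 0 k) (Matrix.diagonal d) = rotation (d 0 * (d k)⁻¹) := by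
  rcases hk with rfl | rfl <;>
    simp [weightHom, root, Fin.prod_univ_three, Matrix.diagonal_apply_eq, Pi.single_apply]

theorem canonicalConnection_root {k : Fin 3} (hk : k = 1 ∨ k = 2) (X : Mat) :
    canonicalConnection (root 0 k) X = hat ((X 0 0).im - (X k k).im) 0 0 := by
  rcases hk with rfl | rfl <;>
    simp [canonicalConnection, root, Fin.sum_univ_three, hat_eq, Pi.single_apply, sub_eq_add_neg]

theorem rootMorphism_eq (i j : Fin 3) (X : Mat) :
    rootMorphism i j X = hat 0 (X i j).re (X i j).im := by
  simp [rootMorphism, hat_eq]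

/-- The element of `su(3)` with entry `z` at `(i, j)`, in the root space of `root i j`. -/
noncomputable def rootVector (i j : Fin 3) (z : ℂ) : Mat := Matrix.single i j z - Matrix.single j i (star z)

theorem rootVector_mem {i j : Fin 3} (h : i ≠ j) (z : ℂ) : rootVector i j z ∈ su3 := by
  refine ⟨?_, ?_⟩
  · simp [rootVector, Matrix.conjTranspose_sub, Matrix.conjTranspose_single]
  · simp [rootVector, Matrix.trace_sub, Matrix.trace_single_eq_of_ne, h, h.symm]

theorem rootVector_add (i j : Fin 3) (z w : ℂ) :
    rootVector i j (z + w) = rootVector i j z + rootVector i j w := by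
  simp only [rootVector, star_add, Matrix.single_add]; abel

theorem rootVector_smul (i j : Fin 3) (t : ℝ) (z : ℂ) :
    rootVector i j (t * z) = t • rootVector i j z := by
  have h : star ((t : ℂ) * z) = t • star z := by simp
  rw [rootVector, rootVector, h, ← Complex.real_smul, smul_sub, Matrix.smul_single,
    Matrix.smul_single]

/-- The torus preserves each root space and acts on its complex coordinate by a character;
equivariance is tested against these characters. -/
theorem diagonal_conj_rootVector (d : Fin 3 → ℂ) (i j : Fin 3) (z : ℂ) :
    (Matrix.diagonal d)ᴴ * rootVector i j z * Matrix.diagonal d =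
      rootVector i j (star (d i) * z * d j) := by
  ext a b
  rw [Matrix.diagonal_conjTranspose, Matrix.mul_diagonal, Matrix.diagonal_mul]
  simp only [rootVector, Matrix.sub_apply, Matrix.single_apply, Pi.star_apply, star_mul', star_star]
  by_cases h1 : i = a ∧ j = b
  · by_cases h2 : j = a ∧ i = b
    · rw [if_pos h1, if_pos h2, if_pos h1, if_pos h2, ← h1.1, ← h1.2, mul_sub, sub_mul]
      obtain rfl : i = j := h1.1.trans h2.1.symm
      ring
    · rw [if_pos h1, if_neg h2, if_pos h1, if_neg h2, ← h1.1, ← h1.2]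
      ring
  · by_cases h2 : j = a ∧ i = b
    · rw [if_neg h1, if_pos h2, if_neg h1, if_pos h2, ← h2.1, ← h2.2]
      ring
    · rw [if_neg h1, if_neg h2, if_neg h1, if_neg h2]
      ring

theorem su3_decomposition {k j : Fin 3} (h : (k = 1 ∧ j = 2) ∨ (k = 2 ∧ j = 1)) {X : Mat}
    (hX : X ∈ su3) : X = Matrix.diagonal (fun i => X i i) + rootVector 0 k (X 0 k) +
      rootVector 0 j (X 0 j) + rootVector k j (X k j) := by
  have hs : ∀ a b, -X b a = star (X a b) := fun a b => (congrFun (congrFun hX.1 b) a).symm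
  have hs : ∀ a b, X b a = -star (X a b) := fun a b => by rw [← hs, neg_neg]
  rcases h with ⟨rfl, rfl⟩ | ⟨rfl, rfl⟩
  all_goals
    ext a b
    have h01 := hs 0 1
    have h02 := hs 0 2
    have h12 := hs 1 2
    have h21 := hs 2 1
    fin_cases a <;> fin_cases b <;> simp [rootVector] <;> assumption

theorem diagonal_mem_su3 {X : Mat} (hX : X ∈ su3) : Matrix.diagonal (fun i => X i i) ∈ su3 := by
  refine ⟨?_, ?_⟩
  · ext a b
    have h := congrFun (congrFun hX.1 a) a
    rw [Matrix.diagonal_conjTranspose, Matrix.neg_apply, Matrix.diagonal_apply,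
      Matrix.diagonal_apply]
    split_ifs
    · exact h
    · simp
  · simpa [Matrix.trace] using hX.2


theorem exists_other_index {k : Fin 3} (hk : k = 1 ∨ k = 2) :
    ∃ j : Fin 3, (k = 1 ∧ j = 2) ∨ (k = 2 ∧ j = 1) := by
  rcases hk with rfl | rfl
  · exact ⟨2, Or.inl ⟨rfl, rfl⟩⟩
  · exact ⟨1, Or.inr ⟨rfl, rfl⟩⟩

/-- For each choice of `d 0 = u`, `d k = v` on the unit circle there is an element of the torus. -/
theorem exists_torus {k j : Fin 3} (h : (k = 1 ∧ j = 2) ∨ (k = 2 ∧ j = 1)) {u v : ℂ}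
    (hu : u * star u = 1) (hv : v * star v = 1) :
    ∃ d : Fin 3 → ℂ, d 0 = u ∧ d k = v ∧ d j = star (u * v) ∧ Matrix.diagonal d ∈ torus := by
  have huv : u * v * star (u * v) = 1 := by
    rw [star_mul']
    calc u * v * (star u * star v) = (u * star u) * (v * star v) := by ring
      _ = 1 := by rw [hu, hv, mul_one]
  have huv' : star (u * v) * star (star (u * v)) = 1 := by rw [star_star, mul_comm, huv]
  rcases h with ⟨rfl, rfl⟩ | ⟨rfl, rfl⟩
  · refine ⟨![u, v, star (u * v)], rfl, rfl, rfl, diagonal_mem_torus (fun i => ?_) huv⟩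
    fin_cases i
    exacts [hu, hv, huv']
  · refine ⟨![u, star (u * v), v], rfl, rfl, rfl, diagonal_mem_torus (fun i => ?_) ?_⟩
    · fin_cases i
      exacts [hu, huv', hv]
    · calc u * star (u * v) * v = u * v * star (u * v) := by ring
        _ = 1 := huv

theorem contDiffOn_entry {S : Set ℝ} {f : ℝ → Mat → MatR} (hf : SmoothOver S f) {g : Mat}
    (hg : g ∈ SU3) (i j : Fin 3) : ContDiffOn ℝ ∞ (fun s => f s g i j) S := by
  have h1 : ContDiffOn ℝ ∞ (fun s => f s g) S :=
    hf.comp (contDiffOn_id.prodMk contDiffOn_const) (fun s hs => ⟨hs, hg⟩)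
  have h2 : ContDiff ℝ ∞ (fun B : MatR => B i j) :=
    (LinearMap.toContinuousLinearMap (Matrix.entryLinearMap ℝ ℝ i j : MatR →ₗ[ℝ] ℝ)).contDiff
  exact h2.comp_contDiffOn h1

/-- `rotation (-1)` is the half turn about the axis `L₁`: it fixes `L₁` and negates `L₂` and `L₃`.
-/
theorem eq_hat_of_commute_half_turn {B : MatR} (hB : Bᵀ = -B)
    (h : B = (rotation (-1))ᵀ * B * rotation (-1)) : B = hat (B 2 1) 0 0 := by
  obtain ⟨a, b, d, rfl⟩ : ∃ a b d, B = hat a b d := ⟨_, _, _, exists_eq_hat hB⟩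
  rw [rotation_conj_hat _ (by simp), hat_inj] at h
  simp only [Complex.neg_re, Complex.one_re, Complex.neg_im, Complex.one_im] at h
  rw [hat_inj]
  exact ⟨by simp [hat], by linarith [h.2.1], by linarith [h.2.2]⟩

theorem eq_hat_of_anticommute_half_turn {B : MatR} (hB : Bᵀ = -B)
    (h : -B = (rotation (-1))ᵀ * B * rotation (-1)) : B = hat 0 (B 0 2) (B 1 0) := by
  obtain ⟨a, b, d, rfl⟩ : ∃ a b d, B = hat a b d := ⟨_, _, _, exists_eq_hat hB⟩
  rw [rotation_conj_hat _ (by simp), neg_hat, hat_inj] at h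
  rw [hat_inj]
  exact ⟨by linarith [h.1], by simp [hat], by simp [hat]⟩

theorem eq_zero_of_neg_eq_conj_rotation_one {B : MatR} (hB : Bᵀ = -B)
    (h : -B = (rotation 1)ᵀ * B * rotation 1) : B = 0 := by
  obtain ⟨a, b, d, rfl⟩ : ∃ a b d, B = hat a b d := ⟨_, _, _, exists_eq_hat hB⟩
  rw [rotation_conj_hat _ (by simp), neg_hat, hat_inj] at h
  simp only [Complex.one_re, Complex.one_im] at h
  rw [← hat_zero, hat_inj]
  exact ⟨by linarith [h.1], by linarith [h.2.1], by linarith [h.2.2]⟩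

/-- A form of Schur's lemma, in which three torus elements replace the whole torus. -/
theorem exists_isInvariantForm {k : Fin 3} (hk : k = 1 ∨ k = 2) {S : Set ℝ} {A : OneForm}
    {Φ : ℝ → Mat → MatR} (hA : IsConnection (root 0 k) S A) (hΦ : IsSection (root 0 k) S Φ)
    (hI : IsInvariant S A Φ) :
    ∃ q b d φ : ℝ → ℝ, ContDiffOn ℝ ∞ q S ∧ ContDiffOn ℝ ∞ b S ∧ ContDiffOn ℝ ∞ d S ∧
      ContDiffOn ℝ ∞ φ S ∧ IsInvariantForm k S q b d φ A Φ := by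
  obtain ⟨j, hj⟩ := exists_other_index hk
  have h0k : (0 : Fin 3) ≠ k := by rcases hk with rfl | rfl <;> decide
  have h0j : (0 : Fin 3) ≠ j := by rcases hj with ⟨rfl, rfl⟩ | ⟨rfl, rfl⟩ <;> decide
  have hkj : k ≠ j := by rcases hj with ⟨rfl, rfl⟩ | ⟨rfl, rfl⟩ <;> decide
  -- In the positions `0, k, j` the three elements are `(-1, -1, 1)`, `(-1, 1, -1)` and `(1, i,
  -- -i)`. The first lies in the kernel of `α` but negates the other two root spaces, so `A`
  -- vanishes there. The second acts on `so(3)` by the half turn, which forces `Φ` and the radial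
  -- part of `A` into the span of `L₁` and the root part into that of `L₂, L₃`. The third multiplies
  -- the root space of `α` by `i`, which ties the value at `i` to the value at `1`.
  obtain ⟨d₁, d₁0, d₁k, d₁j, ht₁⟩ := exists_torus hj (u := -1) (v := -1) (by simp) (by simp)
  obtain ⟨d₂, d₂0, d₂k, d₂j, ht₂⟩ := exists_torus hj (u := -1) (v := 1) (by simp) (by simp)
  obtain ⟨d₃, d₃0, d₃k, d₃j, ht₃⟩ := exists_torus hj (u := 1) (v := Complex.I) (by simp) (by simp)
  have w₁ : weightHom (root 0 k) (Matrix.diagonal d₁) = rotation 1 := by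
    rw [weightHom_diagonal hk, d₁0, d₁k]; norm_num
  have w₂ : weightHom (root 0 k) (Matrix.diagonal d₂) = rotation (-1) := by
    rw [weightHom_diagonal hk, d₂0, d₂k]; norm_num
  have w₃ : weightHom (root 0 k) (Matrix.diagonal d₃) = rotation (-Complex.I) := by
    rw [weightHom_diagonal hk, d₃0, d₃k]; simp
  have hone : ∀ s ∈ S, ∀ g ∈ SU3, ∀ V : Tan, V.2 ∈ su3 → A s g V = A s 1 V := by
    intro s hs g hg V hV
    have := (hI s hs g hg 1 SU3.one_mem).1 V hV
    rwa [Matrix.mul_one] at this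
  have hΦone : ∀ s ∈ S, ∀ g ∈ SU3, Φ s g = Φ s 1 := by
    intro s hs g hg
    have := (hI s hs g hg 1 SU3.one_mem).2
    rwa [Matrix.mul_one] at this
  have heq : ∀ s ∈ S, ∀ t ∈ torus, ∀ V : Tan, V.2 ∈ su3 →
      A s 1 (V.1, tᴴ * V.2 * t) = (weightHom (root 0 k) t)ᵀ * A s 1 V * weightHom (root 0 k) t := by
    intro s hs t ht V hV
    rw [← hA.equivariant s hs 1 SU3.one_mem t ht V hV, Matrix.one_mul]
    refine (hone s hs t ht.1 _ ?_).symm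
    have := su3.conj_mem hV (SU3.conjTranspose_mem ht.1)
    rwa [Matrix.conjTranspose_conjTranspose] at this
  have hskew : ∀ s ∈ S, ∀ V : Tan, V.2 ∈ su3 → (A s 1 V)ᵀ = -A s 1 V := fun s hs V hV =>
    hA.skew s hs 1 SU3.one_mem V hV
  have hroot : ∀ s ∈ S, ∀ m n : Fin 3, m ≠ n → ∀ z : ℂ, ∀ d : Fin 3 → ℂ,
      Matrix.diagonal d ∈ torus → A s 1 (0, rootVector m n (star (d m) * z * d n)) =
        (weightHom (root 0 k) (Matrix.diagonal d))ᵀ * A s 1 (0, rootVector m n z) *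
          weightHom (root 0 k) (Matrix.diagonal d) := by
    intro s hs m n hmn z d hd
    rw [← heq s hs _ hd (0, rootVector m n z) (rootVector_mem hmn z), diagonal_conj_rootVector]
  have hnegroot : ∀ m n : Fin 3, ∀ z : ℂ, rootVector m n (-z) = -rootVector m n z := by
    intro m n z
    have := rootVector_smul m n (-1) z
    simpa using this
  have hneg : ∀ s, ∀ m n : Fin 3, ∀ z : ℂ,
      A s 1 (0, rootVector m n (-z)) = -A s 1 (0, rootVector m n z) := by
    intro s m n z
    rw [hnegroot, ← map_neg, Prod.neg_mk, neg_zero]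
  refine ⟨fun s => A s 1 (1, 0) 2 1, fun s => A s 1 (0, rootVector 0 k 1) 0 2,
    fun s => A s 1 (0, rootVector 0 k 1) 1 0, fun s => Φ s 1 2 1,
    contDiffOn_entry (hA.smooth _) SU3.one_mem _ _, contDiffOn_entry (hA.smooth _) SU3.one_mem _ _,
    contDiffOn_entry (hA.smooth _) SU3.one_mem _ _, contDiffOn_entry hΦ.smooth SU3.one_mem _ _,
    fun s hs g hg V hV => ?_, fun s hs g hg => ?_⟩
  · rw [hone s hs g hg V hV]
    have hrad : A s 1 (1, 0) = hat (A s 1 (1, 0) 2 1) 0 0 := by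
      have h := heq s hs _ ht₂ (1, 0) su3.zero_mem
      simp only [Matrix.mul_zero, Matrix.zero_mul, w₂] at h
      exact eq_hat_of_commute_half_turn (hskew s hs (1, 0) su3.zero_mem) h
    have hzero : ∀ m n : Fin 3, m ≠ n → star (d₁ m) * d₁ n = -1 → ∀ z,
        A s 1 (0, rootVector m n z) = 0 := by
      intro m n hmn hd z
      have h := hroot s hs m n hmn z d₁ ht₁
      have hz : star (d₁ m) * z * d₁ n = -z := by linear_combination z * hd
      rw [hz, hneg, w₁] at h
      exact eq_zero_of_neg_eq_conj_rotation_one (hskew s hs _ (rootVector_mem hmn z)) h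
    have hone' : A s 1 (0, rootVector 0 k 1) = hat 0 (A s 1 (0, rootVector 0 k 1) 0 2)
        (A s 1 (0, rootVector 0 k 1) 1 0) := by
      have h := hroot s hs 0 k h0k 1 d₂ ht₂
      have hz : star (d₂ 0) * 1 * d₂ k = -1 := by rw [d₂0, d₂k]; simp
      rw [hz, hneg, w₂] at h
      exact eq_hat_of_anticommute_half_turn (hskew s hs _ (rootVector_mem h0k 1)) h
    have hI' : A s 1 (0, rootVector 0 k Complex.I) =
        hat 0 (-A s 1 (0, rootVector 0 k 1) 1 0) (A s 1 (0, rootVector 0 k 1) 0 2) := by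
      have h := hroot s hs 0 k h0k 1 d₃ ht₃
      have hz : star (d₃ 0) * 1 * d₃ k = Complex.I := by rw [d₃0, d₃k]; simp
      rw [hz, w₃, hone', rotation_conj_hat _ (by simp)] at h
      rw [h, hat_inj]
      simp
    have hlin : ∀ z : ℂ, A s 1 (0, rootVector 0 k z) =
        z.re • A s 1 (0, rootVector 0 k 1) + z.im • A s 1 (0, rootVector 0 k Complex.I) := by
      intro z
      have hz : rootVector 0 k z = z.re • rootVector 0 k 1 + z.im • rootVector 0 k Complex.I := by
        rw [← rootVector_smul, ← rootVector_smul, ← rootVector_add, mul_one, Complex.re_add_im]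
      rw [hz, ← map_smul, ← map_smul, ← map_add]
      simp
    have hdec : V = V.1 • ((1, 0) : Tan) + (0, Matrix.diagonal fun i => V.2 i i) +
        (0, rootVector 0 k (V.2 0 k)) + (0, rootVector 0 j (V.2 0 j)) +
        (0, rootVector k j (V.2 k j)) := by
      refine Prod.ext (by simp) ?_
      have := su3_decomposition hj hV
      simpa using this
    rw [hdec, map_add, map_add, map_add, map_add, map_smul, ← hdec,
      hA.vertical s hs 1 SU3.one_mem _ (diagonal_mem_su3 hV), canonicalConnection_root hk,
      hzero 0 j h0j (by rw [d₁0, d₁j]; simp), hzero k j hkj (by rw [d₁k, d₁j]; simp),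
      hlin, hI', hone', hrad, connValue]
    simp only [smul_hat, hat_add, add_zero, Matrix.diagonal_apply_eq, hat_inj]
    refine ⟨?_, ?_, ?_⟩ <;> simp [hat] <;> ring
  · rw [hΦone s hs g hg]
    have h := hΦ.equivariant s hs 1 SU3.one_mem _ ht₂
    rw [Matrix.one_mul, hΦone s hs _ ht₂.1] at h
    rw [w₂] at h
    exact eq_hat_of_commute_half_turn (hΦ.skew s hs 1 SU3.one_mem) h


/-! ## Irreducibility -/

theorem exists_weightHom_eq_rotation {k : Fin 3} (hk : k = 1 ∨ k = 2) {t : Mat} (ht : t ∈ torus) :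
    ∃ z : ℂ, z.re ^ 2 + z.im ^ 2 = 1 ∧ weightHom (root 0 k) t = rotation z := by
  obtain ⟨h, d, rfl⟩ := ht
  refine ⟨_, ?_, weightHom_diagonal hk d⟩
  have hd : ∀ i, ‖d i‖ = 1 := by
    intro i
    have h1 := congrFun (congrFun (SU3.mul_star_self h) i) i
    rw [Matrix.diagonal_conjTranspose, Matrix.diagonal_mul_diagonal, Matrix.diagonal_apply_eq,
      Matrix.one_apply_eq, Pi.star_apply, Complex.star_def, Complex.mul_conj] at h1
    have h2 : Complex.normSq (d i) = 1 := by exact_mod_cast h1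
    rw [Complex.normSq_eq_norm_sq] at h2
    nlinarith [norm_nonneg (d i)]
  have hn : ‖d 0 * (d k)⁻¹‖ = 1 := by rw [norm_mul, norm_inv, hd, hd]; norm_num
  have h3 := Complex.normSq_eq_norm_sq (d 0 * (d k)⁻¹)
  rw [hn, Complex.normSq_apply] at h3
  linarith

theorem weightHom_conj_hat_of_torus {k : Fin 3} (hk : k = 1 ∨ k = 2) {t : Mat} (ht : t ∈ torus)
    (a : ℝ) : (weightHom (root 0 k) t)ᵀ * hat a 0 0 * weightHom (root 0 k) t = hat a 0 0 := by
  obtain ⟨z, hz, h⟩ := exists_weightHom_eq_rotation hk ht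
  rw [h, rotation_conj_hat z hz]
  simp

/-- An invariant connection without `Λ_α`-component is reducible. -/
theorem exists_ne_zero_of_irreducible {k : Fin 3} (hk : k = 1 ∨ k = 2) {S : Set ℝ} (hS : IsOpen S)
    (hne : S.Nonempty) {q b d φ : ℝ → ℝ} {A : OneForm} {Φ : ℝ → Mat → MatR}
    (hA : IsInvariantForm k S q b d φ A Φ) (hI : IsIrreducible (root 0 k) S A) :
    ∃ s ∈ S, b s ^ 2 + d s ^ 2 ≠ 0 := by
  by_contra hcon
  push Not at hcon
  have hb : ∀ s ∈ S, b s = 0 := fun s hs => by nlinarith [hcon s hs, sq_nonneg (b s), sq_nonneg (d s)]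
  have hd : ∀ s ∈ S, d s = 0 := fun s hs => by nlinarith [hcon s hs, sq_nonneg (b s), sq_nonneg (d s)]
  obtain ⟨s, hs⟩ := hne
  -- The constant section `L₁` is torus-invariant, and it is parallel once `b = d = 0`. Treating it
  -- as a Higgs field with `φ = 1` gives its covariant derivative.
  have hA' : IsInvariantForm k S q b d (fun _ => 1) A (fun _ _ => hat 1 0 0) :=
    ⟨hA.conn, fun _ _ _ _ => rfl⟩
  have h := hI (fun _ _ => hat 1 0 0) ⟨contDiffOn_const, fun _ _ _ _ => transpose_hat _ _ _,
    fun _ _ _ _ t ht => (weightHom_conj_hat_of_torus hk ht 1).symm⟩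
    (fun s hs g hg V hV => by
      rw [covDeriv_of_invariant hS hA' hs (hasDerivAt_const s (1 : ℝ)) hg hV, hb s hs, hd s hs,
        ← hat_zero]
      congr 1 <;> ring) s hs 1 SU3.one_mem
  rw [← hat_zero, hat_inj] at h
  exact one_ne_zero h.1

/-- The curves stay in `S × SU(3)`, where `f` is smooth. What matters is that one linear map `D`
serves all directions `V`; this linearity is needed for brackets. -/
theorem exists_hasDerivAt_of_smoothOver {S : Set ℝ} (hS : IsOpen S) {f : ℝ → Mat → MatR}
    (hf : SmoothOver S f) {s : ℝ} (hs : s ∈ S) {g : Mat} (hg : g ∈ SU3) :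
    ∃ D : ℝ × Mat →L[ℝ] MatR, ∀ V : Tan, V.2 ∈ su3 →
      HasDerivAt (fun t : ℝ => f (s + t * V.1) (g * NormedSpace.exp (t • V.2)))
        (D (V.1, g * V.2)) 0 := by
  have h := ((hf (s, g) ⟨hs, hg⟩).differentiableWithinAt (by simp)).hasFDerivWithinAt
  refine ⟨_, fun V hV => h.comp_hasDerivAt_of_eq (f := fun t : ℝ =>
    ((s + t * V.1, g * NormedSpace.exp (t • V.2)) : ℝ × Mat)) (0 : ℝ)
    ((hasDerivAt_add_mul s V.1).prodMk (hasDerivAt_mul_exp g V.2)) ?_ (by simp)⟩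
  filter_upwards [eventually_add_mul_mem hS hs V.1] with t ht
  exact ⟨ht, mul_exp_mem_SU3 hg hV t⟩

theorem exp_conj_smul {X : Mat} {U : Mat} (hU : U ∈ SU3) (t : ℝ) :
    NormedSpace.exp (t • (U * X * Uᴴ)) = U * NormedSpace.exp (t • X) * Uᴴ := by
  have h1 : U⁻¹ = Uᴴ := Matrix.inv_eq_right_inv (SU3.mul_star_self hU)
  have h2 : IsUnit U := (Matrix.isUnit_iff_isUnit_det _).2
    (Matrix.isUnit_det_of_right_inverse (SU3.mul_star_self hU))
  rw [← h1, ← Matrix.exp_conj _ _ h2, Matrix.mul_smul, Matrix.smul_mul]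

theorem exp_add_smul (X : Mat) (s t : ℝ) :
    NormedSpace.exp ((s + t) • X) = NormedSpace.exp (s • X) * NormedSpace.exp (t • X) := by
  rw [add_smul]
  exact Matrix.exp_add_of_commute _ _ (((Commute.refl X).smul_left s).smul_right t)

/-- A function whose derivative along `X` vanishes is constant along the flow of `X`. -/
theorem eq_of_dirDeriv_eq_zero {S : Set ℝ} (hS : IsOpen S) {f : ℝ → Mat → MatR}
    (hf : SmoothOver S f) {s : ℝ} (hs : s ∈ S) {X : Mat} (hX : X ∈ su3)
    (h : ∀ g ∈ SU3, dirDeriv f s g (0, X) = 0) {g : Mat} (hg : g ∈ SU3) (t : ℝ) :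
    f s (g * NormedSpace.exp (t • X)) = f s g := by
  have hder : ∀ t₀ : ℝ, HasDerivAt (fun t : ℝ => f s (g * NormedSpace.exp (t • X))) 0 t₀ := by
    intro t₀
    obtain ⟨D, hD⟩ := exists_hasDerivAt_of_smoothOver hS hf hs (mul_exp_mem_SU3 hg hX t₀)
    have h1 := hD (0, X) hX
    have h2 : D (0, g * NormedSpace.exp (t₀ • X) * X) = 0 := by
      rw [← h _ (mul_exp_mem_SU3 hg hX t₀)]
      exact h1.deriv.symm
    simp only [mul_zero, add_zero] at h1
    rw [h2] at h1
    have h3 : HasDerivAt (fun t : ℝ => f s (g * NormedSpace.exp (t₀ • X) *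
        NormedSpace.exp ((t - t₀) • X))) 0 t₀ := by
      have h1' : HasDerivAt (fun t : ℝ => f s (g * NormedSpace.exp (t₀ • X) *
        NormedSpace.exp (t • X))) 0 (t₀ - t₀) := by rw [sub_self]; exact h1
      have := HasDerivAt.scomp (h := fun t => t - t₀) t₀ h1' ((hasDerivAt_id t₀).sub_const t₀)
      rw [smul_zero] at this
      exact this
    refine h3.congr_of_eventuallyEq (Filter.Eventually.of_forall fun t => ?_)
    simp only
    rw [Matrix.mul_assoc, ← exp_add_smul, add_sub_cancel]
  have hc := is_const_of_deriv_eq_zero (fun t => (hder t).differentiableAt)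
    (fun t => (hder t).deriv) t 0
  simpa using hc

/-- If the derivatives along `X` and `Y` vanish everywhere, so does the one along `[X, Y]`. -/
theorem dirDeriv_bracket_eq_zero {S : Set ℝ} (hS : IsOpen S) {f : ℝ → Mat → MatR}
    (hf : SmoothOver S f) {s : ℝ} (hs : s ∈ S) {X Y : Mat} (hX : X ∈ su3) (hY : Y ∈ su3)
    (h : ∀ g ∈ SU3, dirDeriv f s g (0, X) = 0) (h' : ∀ g ∈ SU3, dirDeriv f s g (0, Y) = 0)
    {g : Mat} (hg : g ∈ SU3) : dirDeriv f s g (0, X * Y - Y * X) = 0 := by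
  obtain ⟨D, hD⟩ := exists_hasDerivAt_of_smoothOver hS hf hs hg
  -- The flow of `U Y U*` is a flow along `X`, then `Y`, then back along `X`, each of which leaves
  -- `f` unchanged. Differentiating the resulting identity at `t = 0` turns `U Y U*` into `[X, Y]`.
  have hzero : ∀ t : ℝ, D (0, g * (NormedSpace.exp (t • X) * Y * (NormedSpace.exp (t • X))ᴴ)) = 0 := by
    intro t
    set U := NormedSpace.exp (t • X) with hU
    have hUm : U ∈ SU3 := exp_mem_SU3 (su3.smul_mem hX t)
    have hZ := su3.conj_mem hY hUm
    have h1 := hD (0, U * Y * Uᴴ) hZ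
    refine h1.unique ?_
    have hconst : ∀ τ : ℝ, f (s + τ * 0) (g * NormedSpace.exp (τ • (U * Y * Uᴴ))) = f s g := by
      intro τ
      have hUh : Uᴴ = NormedSpace.exp ((-t) • X) := by
        rw [hU, conjTranspose_exp_smul hX, smul_neg, neg_smul]
      have hg1 : g * U ∈ SU3 := SU3.mul_mem hg hUm
      rw [mul_zero, add_zero, exp_conj_smul hUm, ← Matrix.mul_assoc, ← Matrix.mul_assoc, hUh,
        eq_of_dirDeriv_eq_zero hS hf hs hX h (mul_exp_mem_SU3 hg1 hY τ),
        eq_of_dirDeriv_eq_zero hS hf hs hY h' hg1, hU, eq_of_dirDeriv_eq_zero hS hf hs hX h hg]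
    refine (hasDerivAt_const (0 : ℝ) (f s g)).congr_of_eventuallyEq
      (Filter.Eventually.of_forall hconst)
  have hc : HasDerivAt (fun t : ℝ =>
      D (0, g * (NormedSpace.exp (t • X) * Y * (NormedSpace.exp (t • X))ᴴ)))
      (D (0, g * (X * Y - Y * X))) 0 :=
    D.hasFDerivAt.comp_hasDerivAt (0 : ℝ)
      ((hasDerivAt_const (0 : ℝ) (0 : ℝ)).prodMk (hasDerivAt_conj_exp_smul g X Y hX))
  have hz : D (0, g * (X * Y - Y * X)) = 0 := by
    refine hc.unique ?_
    refine (hasDerivAt_const (0 : ℝ) (0 : MatR)).congr_of_eventuallyEq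
      (Filter.Eventually.of_forall hzero)
  exact (hD (0, X * Y - Y * X) (su3.bracket_mem hX hY)).deriv.trans hz

/-- The two root spaces other than that of `α` generate it by brackets. This is how a connection
that vanishes on them still has full holonomy. -/
theorem bracket_rootVector {k j : Fin 3} (h : (k = 1 ∧ j = 2) ∨ (k = 2 ∧ j = 1)) (z : ℂ) :
    rootVector 0 j 1 * rootVector k j z - rootVector k j z * rootVector 0 j 1 =
      rootVector 0 k (-star z) := by
  rcases h with ⟨rfl, rfl⟩ | ⟨rfl, rfl⟩
  all_goals
    ext a b
    simp only [Matrix.sub_apply, Matrix.mul_apply, Fin.sum_univ_three, rootVector]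
    fin_cases a <;> fin_cases b <;> simp

theorem isIrreducible_of_invariant {k : Fin 3} (hk : k = 1 ∨ k = 2) {S : Set ℝ} (hS : IsOpen S)
    {q b d φ : ℝ → ℝ} {A : OneForm} {Φ : ℝ → Mat → MatR} (hA : IsInvariantForm k S q b d φ A Φ)
    (hb : ∀ s ∈ S, b s ≠ 0) (hd : ∀ s ∈ S, d s = 0) : IsIrreducible (root 0 k) S A := by
  intro η hη hpar s hs g hg
  obtain ⟨j, hj⟩ := exists_other_index hk
  have h0k : (0 : Fin 3) ≠ k := by rcases hk with rfl | rfl <;> decide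
  have h0j : (0 : Fin 3) ≠ j := by rcases hj with ⟨rfl, rfl⟩ | ⟨rfl, rfl⟩ <;> decide
  have hkj : k ≠ j := by rcases hj with ⟨rfl, rfl⟩ | ⟨rfl, rfl⟩ <;> decide
  have hdir : ∀ X ∈ su3, ∀ g ∈ SU3, A s g (0, X) = 0 → dirDeriv η s g (0, X) = 0 := by
    intro X hX g hg h0
    have := hpar s hs g hg (0, X) hX
    rwa [covDeriv, h0, Matrix.zero_mul, Matrix.mul_zero, sub_zero, add_zero] at this
  have h1 : ∀ g ∈ SU3, dirDeriv η s g (0, rootVector 0 j 1) = 0 := by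
    intro g hg
    refine hdir _ (rootVector_mem h0j 1) g hg ?_
    rw [hA.conn s hs g hg _ (rootVector_mem h0j 1), connValue, ← hat_zero]
    rcases hj with ⟨rfl, rfl⟩ | ⟨rfl, rfl⟩ <;> simp [rootVector]
  have h2 : ∀ z, ∀ g ∈ SU3, dirDeriv η s g (0, rootVector k j z) = 0 := by
    intro z g hg
    refine hdir _ (rootVector_mem hkj z) g hg ?_
    rw [hA.conn s hs g hg _ (rootVector_mem hkj z), connValue, ← hat_zero]
    rcases hj with ⟨rfl, rfl⟩ | ⟨rfl, rfl⟩ <;> simp [rootVector]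
  have h3 : ∀ z, dirDeriv η s g (0, rootVector 0 k z) = 0 := by
    intro z
    have := dirDeriv_bracket_eq_zero hS hη.smooth hs (rootVector_mem h0j 1)
      (rootVector_mem hkj (-star z)) h1 (h2 _) hg
    rwa [bracket_rootVector hj, star_neg, star_star, neg_neg] at this
  obtain ⟨e₁, e₂, e₃, he⟩ : ∃ e₁ e₂ e₃, η s g = hat e₁ e₂ e₃ :=
    ⟨_, _, _, exists_eq_hat (hη.skew s hs g hg)⟩
  -- The derivative of `η` along the root space of `α` is zero, so only the commutator term of the
  -- covariant derivative is left.
  have h4 : ∀ z : ℂ, hat 0 (b s * z.re) (b s * z.im) * hat e₁ e₂ e₃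
      - hat e₁ e₂ e₃ * hat 0 (b s * z.re) (b s * z.im) = 0 := by
    intro z
    have h5 := hpar s hs g hg (0, rootVector 0 k z) (rootVector_mem h0k z)
    have h6 : connValue k (q s) (b s) (d s) (0, rootVector 0 k z) =
        hat 0 (b s * z.re) (b s * z.im) := by
      rw [connValue, hd s hs, hat_inj]
      rcases hk with rfl | rfl <;> simp [rootVector]
    rwa [covDeriv, h3, zero_add, hA.conn s hs g hg _ (rootVector_mem h0k z), he, h6] at h5
  have h5 := h4 1
  have h6 := h4 Complex.I
  rw [hat_bracket, ← hat_zero, hat_inj] at h5 h6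
  simp [hb s hs] at h5 h6
  rw [he, h5.1, h5.2, h6.1, hat_zero]


/-! ## The profile function and the radius -/

theorem contDiff_profile : ContDiff ℝ ∞ profile := by
  have h : ContDiff ℝ ∞ (fun s : ℝ => 1 + s ^ 2) := contDiff_const.add (contDiff_id.pow 2)
  exact h.rpow_const_of_ne (fun s => by positivity)

theorem continuous_profile : Continuous profile := contDiff_profile.continuous

theorem profile_le_one (s : ℝ) : profile s ≤ 1 :=
  Real.rpow_le_one_of_one_le_of_nonpos (by nlinarith [sq_nonneg s]) (by norm_num)

theorem inv_le_profile {a s : ℝ} (ha : 0 < a) (h : 1 + s ^ 2 ≤ a ^ 4) : a⁻¹ ≤ profile s := by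
  have h1 : (a ^ 4) ^ (-(1 / 4) : ℝ) = a⁻¹ := by
    rw [← Real.rpow_natCast, ← Real.rpow_mul ha.le]
    norm_num
    exact Real.rpow_neg_one a
  rw [← h1]
  exact Real.rpow_le_rpow_of_nonpos (by positivity) h (by norm_num)

theorem hasDerivAt_radius (s : ℝ) : HasDerivAt radius (profile s) s :=
  intervalIntegral.integral_hasDerivAt_right (continuous_profile.intervalIntegrable _ _)
    (continuous_profile.stronglyMeasurableAtFilter _ _) continuous_profile.continuousAt

theorem radius_zero : radius 0 = 0 := intervalIntegral.integral_same

theorem mul_le_radius {c s : ℝ} (hs : 0 ≤ s) (h : ∀ t ∈ Icc 0 s, c ≤ profile t) :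
    c * s ≤ radius s := by
  have := intervalIntegral.integral_mono_on hs
    (continuous_const.intervalIntegrable (μ := MeasureTheory.volume) 0 s)
    (continuous_profile.intervalIntegrable 0 s) h
  rw [intervalIntegral.integral_const, smul_eq_mul, sub_zero, mul_comm] at this
  exact this

theorem radius_le {s : ℝ} (hs : 0 ≤ s) : radius s ≤ s := by
  have := intervalIntegral.integral_mono_on hs (continuous_profile.intervalIntegrable 0 s)
    (continuous_const.intervalIntegrable (μ := MeasureTheory.volume) 0 s) (fun t _ => profile_le_one t)
  rw [intervalIntegral.integral_const, smul_eq_mul, sub_zero, mul_one] at this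
  exact this

theorem exists_radius_eq {ε : ℝ} (hε : 0 < ε) : ∃ s : ℝ, 0 < s ∧ radius s = ε := by
  -- The endpoint `2ε + ε²` is chosen so that one plus it is `(1 + ε)²`. Up to there the profile is
  -- at least `1/(1 + ε)`, which makes the radius of the endpoint at least `ε`.
  have h0 : 0 ≤ 2 * ε + ε ^ 2 := by positivity
  have h1 : ε ≤ radius (2 * ε + ε ^ 2) := by
    refine le_trans ?_ (mul_le_radius (c := (1 + ε)⁻¹) h0 fun t ht => ?_)
    · rw [inv_mul_eq_div, le_div_iff₀ (by positivity)]
      nlinarith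
    · refine inv_le_profile (by positivity) ?_
      have : (1 + ε) ^ 4 = (1 + (2 * ε + ε ^ 2)) ^ 2 := by ring
      rw [this]
      nlinarith [ht.1, ht.2, mul_le_mul ht.2 ht.2 ht.1 h0]
  have hcont : ContinuousOn radius (Icc 0 (2 * ε + ε ^ 2)) := fun s _ =>
    (hasDerivAt_radius s).continuousAt.continuousWithinAt
  obtain ⟨s, hs, hs'⟩ := intermediate_value_Icc h0 hcont ⟨by rw [radius_zero]; exact hε.le, h1⟩
  refine ⟨s, lt_of_le_of_ne hs.1 ?_, hs'⟩
  rintro rfl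
  rw [radius_zero] at hs'
  exact hε.ne hs'

/-! ## Local solutions of the monopole equations -/

/-- The right hand side of the equation for `b`. -/
noncomputable def connRate (k : Fin 3) (s b φ : ℝ) : ℝ :=
  (higgsSign k * profile s * φ - 1 / s) * b

/-- The right hand side of the equation for `φ`. -/
noncomputable def higgsRate (k : Fin 3) (s b : ℝ) : ℝ :=
  higgsSign k * (1 / (2 * s ^ 2 * profile s) - profile s ^ 3 / 2 + profile s ^ 3 * b ^ 2 / 4)

theorem higgsSign_mul_self (k : Fin 3) : higgsSign k * higgsSign k = 1 := by
  unfold higgsSign; split_ifs <;> norm_num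

/-- The vector field of the monopole equations. -/
noncomputable def monopoleField (k : Fin 3) (p : ℝ × ℝ × ℝ) : ℝ × ℝ × ℝ :=
  (1, connRate k p.1 p.2.1 p.2.2, higgsRate k p.1 p.2.1)

theorem contDiffOn_monopoleField (k : Fin 3) :
    ContDiffOn ℝ ∞ (monopoleField k) {p | 0 < p.1} := by
  have h1 : ContDiffOn ℝ ∞ (fun p : ℝ × ℝ × ℝ => p.1) {p | 0 < p.1} := contDiffOn_fst
  have h2 : ContDiffOn ℝ ∞ (fun p : ℝ × ℝ × ℝ => p.2.1) {p | 0 < p.1} :=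
    (contDiff_fst.comp contDiff_snd).contDiffOn
  have h3 : ContDiffOn ℝ ∞ (fun p : ℝ × ℝ × ℝ => p.2.2) {p | 0 < p.1} :=
    (contDiff_snd.comp contDiff_snd).contDiffOn
  have hF : ContDiffOn ℝ ∞ (fun p : ℝ × ℝ × ℝ => profile p.1) {p | 0 < p.1} :=
    (contDiff_profile.comp contDiff_fst).contDiffOn
  refine contDiffOn_const.prodMk (ContDiffOn.prodMk ?_ ?_)
  · exact (((contDiffOn_const.mul hF).mul h3).sub
      (contDiffOn_const.div h1 fun p hp => ne_of_gt hp)).mul h2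
  · refine contDiffOn_const.mul (((contDiffOn_const.div ((contDiffOn_const.mul (h1.pow 2)).mul hF)
      fun p hp => ?_).sub ((hF.pow 3).div_const 2)).add (((hF.pow 3).mul (h2.pow 2)).div_const 4))
    have : (0 : ℝ) < p.1 := hp
    have := profile_pos p.1
    positivity

/-- The variable `s` is carried as a first coordinate of speed one, which makes the system
autonomous and smooth on the half space `s > 0`. Positivity of `b` near `s₀` is continuity. -/
theorem exists_local_solution (k : Fin 3) {s₀ : ℝ} (hs₀ : 0 < s₀) (x : ℝ) {y : ℝ} (hy : 0 < y) :
    ∃ (r : ℝ) (b φ : ℝ → ℝ), 0 < r ∧ Ioo (s₀ - r) (s₀ + r) ⊆ Ioi 0 ∧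
      ContDiffOn ℝ ∞ b (Ioo (s₀ - r) (s₀ + r)) ∧ ContDiffOn ℝ ∞ φ (Ioo (s₀ - r) (s₀ + r)) ∧
      b s₀ = y ∧ φ s₀ = x ∧ ∀ s ∈ Ioo (s₀ - r) (s₀ + r), 0 < b s ∧
        HasDerivAt b (connRate k s (b s) (φ s)) s ∧ HasDerivAt φ (higgsRate k s (b s)) s := by
  have hopen : IsOpen {p : ℝ × ℝ × ℝ | 0 < p.1} := isOpen_lt continuous_const continuous_fst
  have hat : ContDiffAt ℝ 1 (monopoleField k) (s₀, y, x) :=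
    ((contDiffOn_monopoleField k).contDiffAt (hopen.mem_nhds hs₀)).of_le (by norm_cast)
  obtain ⟨α, hα0, r₀, hr₀, hα⟩ :=
    hat.exists_forall_mem_closedBall_exists_eq_forall_mem_Ioo_hasDerivAt₀ s₀
  have hfst : ∀ s ∈ Ioo (s₀ - r₀) (s₀ + r₀), (α s).1 = s := by
    have hd : ∀ s ∈ Ioo (s₀ - r₀) (s₀ + r₀), HasDerivAt (fun s => (α s).1 - s) 0 s := by
      intro s hs
      have h1 : HasDerivAt (fun s => (α s).1) 1 s :=
        (ContinuousLinearMap.fst ℝ ℝ (ℝ × ℝ)).hasFDerivAt.comp_hasDerivAt s (hα s hs)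
      have := h1.sub (hasDerivAt_id s)
      rw [sub_self] at this
      exact this
    intro s hs
    have hmem : s₀ ∈ Ioo (s₀ - r₀) (s₀ + r₀) := ⟨by linarith, by linarith⟩
    have := isOpen_Ioo.is_const_of_deriv_eq_zero isPreconnected_Ioo
      (fun s hs => (hd s hs).differentiableAt.differentiableWithinAt)
      (fun s hs => (hd s hs).deriv) hs hmem
    rw [hα0] at this
    linarith
  have hcont : ContinuousAt (fun s => (α s).2.1) s₀ :=
    (hα s₀ ⟨by linarith, by linarith⟩).continuousAt.snd.fst
  have hpos : ∀ᶠ s in 𝓝 s₀, 0 < (α s).2.1 := by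
    refine hcont.eventually (lt_mem_nhds ?_)
    simp only [hα0]; exact hy
  obtain ⟨r₁, hr₁, hball⟩ := Metric.eventually_nhds_iff.1 hpos
  obtain ⟨r, hr, h0, h1, h2⟩ : ∃ r, 0 < r ∧ r < r₀ ∧ r < r₁ ∧ r < s₀ :=
    ⟨min r₀ (min r₁ s₀) / 2, by positivity, by
      have := min_le_left r₀ (min r₁ s₀); have : 0 < min r₀ (min r₁ s₀) := by positivity
      linarith, by
      have := (min_le_right r₀ (min r₁ s₀)).trans (min_le_left _ _)
      have : 0 < min r₀ (min r₁ s₀) := by positivity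
      linarith, by
      have := (min_le_right r₀ (min r₁ s₀)).trans (min_le_right _ _)
      have : 0 < min r₀ (min r₁ s₀) := by positivity
      linarith⟩
  have hsub : Icc (s₀ - r) (s₀ + r) ⊆ Ioo (s₀ - r₀) (s₀ + r₀) := fun s hs =>
    ⟨by linarith [hs.1], by linarith [hs.2]⟩
  -- Picard-Lindelöf supplies a differentiable curve; smoothness follows from that of the field, on
  -- a closed interval, which is why `r < r₀` is strict. The bound `r < s₀` keeps the curve in the
  -- half space.
  have hsmooth : ContDiffOn ℝ ∞ α (Icc (s₀ - r) (s₀ + r)) := by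
    refine ODE.contDiffOn_enat_Icc_of_hasDerivWithinAt (f := fun _ => monopoleField k)
      (u := {p | 0 < p.1}) (n := ⊤)
      ((contDiffOn_monopoleField k).comp contDiffOn_snd fun p hp => hp.2)
      (fun s hs => (hα s (hsub hs)).hasDerivWithinAt) (fun s hs => ?_)
    change 0 < (α s).1
    rw [hfst s (hsub hs)]
    linarith [hs.1]
  have hsmooth' := hsmooth.mono Ioo_subset_Icc_self
  refine ⟨r, fun s => (α s).2.1, fun s => (α s).2.2, hr, fun s hs => ?_, hsmooth'.snd.fst,
    hsmooth'.snd.snd, by simp only [hα0], by simp only [hα0], fun s hs => ⟨?_, ?_, ?_⟩⟩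
  · exact lt_trans (by linarith) hs.1
  · refine hball ?_
    rw [Real.dist_eq, abs_lt]
    exact ⟨by linarith [hs.1], by linarith [hs.2]⟩
  · have h3 : HasDerivAt (fun s => (α s).2.1) _ s := ((ContinuousLinearMap.fst ℝ ℝ ℝ).comp
      (ContinuousLinearMap.snd ℝ ℝ (ℝ × ℝ))).hasFDerivAt.comp_hasDerivAt s
        (hα s (hsub (Ioo_subset_Icc_self hs)))
    simpa [monopoleField, hfst s (hsub (Ioo_subset_Icc_self hs))] using h3
  · have h3 : HasDerivAt (fun s => (α s).2.2) _ s := ((ContinuousLinearMap.snd ℝ ℝ ℝ).comp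
      (ContinuousLinearMap.snd ℝ ℝ (ℝ × ℝ))).hasFDerivAt.comp_hasDerivAt s
        (hα s (hsub (Ioo_subset_Icc_self hs)))
    simpa [monopoleField, hfst s (hsub (Ioo_subset_Icc_self hs))] using h3

/-! ## The invariant monopole of a solution -/

/-- The invariant connection `α + b(s) Λ_α`. -/
noncomputable def invariantConnection (k : Fin 3) (b : ℝ → ℝ) : OneForm := fun s _ =>
  { toFun := connValue k 0 (b s) 0
    map_add' := fun V W => by
      simp only [connValue, hat_add, Prod.fst_add, Prod.snd_add, Matrix.add_apply, Complex.add_re,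
        Complex.add_im]
      congr 1 <;> ring
    map_smul' := fun t V => by
      simp only [connValue, smul_hat, Prod.smul_fst, Prod.smul_snd, Matrix.smul_apply,
        Complex.smul_re, Complex.smul_im, smul_eq_mul, RingHom.id_apply]
      congr 1 <;> ring }

theorem invariantConnection_apply (k : Fin 3) (b : ℝ → ℝ) (s : ℝ) (g : Mat) (V : Tan) :
    invariantConnection k b s g V = connValue k 0 (b s) 0 V := rfl

theorem smoothOver_hat {S : Set ℝ} {a b d : ℝ → ℝ} (ha : ContDiffOn ℝ ∞ a S)
    (hb : ContDiffOn ℝ ∞ b S) (hd : ContDiffOn ℝ ∞ d S) :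
    SmoothOver S (fun s _ => hat (a s) (b s) (d s)) := by
  have h : ∀ {f : ℝ → ℝ}, ContDiffOn ℝ ∞ f S → ∀ L : MatR,
      ContDiffOn ℝ ∞ (fun p : ℝ × Mat => f p.1 • L) (S ×ˢ SU3) := fun hf L =>
    (hf.comp contDiffOn_fst fun p hp => hp.1).smul contDiffOn_const
  simp only [SmoothOver, hat_eq]
  exact ((h ha _).add (h hb _)).add (h hd _)

theorem isConnection_invariantConnection {k : Fin 3} (hk : k = 1 ∨ k = 2) {S : Set ℝ} {b : ℝ → ℝ}
    (hb : ContDiffOn ℝ ∞ b S) : IsConnection (root 0 k) S (invariantConnection k b) where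
  smooth V := smoothOver_hat contDiffOn_const ((hb.mul contDiffOn_const).sub contDiffOn_const)
    ((hb.mul contDiffOn_const).add contDiffOn_const)
  skew s hs g hg V hV := transpose_hat _ _ _
  equivariant s hs g hg t ht V hV := by
    obtain ⟨htm, d, rfl⟩ := ht
    have hd : ∀ i, star (d i) * d i = 1 := by
      intro i
      have h1 := congrFun (congrFun (SU3.star_mul_self htm) i) i
      rwa [Matrix.diagonal_conjTranspose, Matrix.diagonal_mul_diagonal, Matrix.diagonal_apply_eq,
        Matrix.one_apply_eq] at h1
    obtain ⟨z, hz, hw⟩ := exists_weightHom_eq_rotation hk ⟨htm, d, rfl⟩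
    have hz' : weightHom (root 0 k) (Matrix.diagonal d) = rotation (d 0 * star (d k)) := by
      rw [weightHom_diagonal hk, inv_eq_of_mul_eq_one_left (hd k)]
    have hre : (d 0 * star (d k)).re = z.re := by
      simpa [rotation] using congrFun (congrFun (hz'.symm.trans hw) 1) 1
    have him : (d 0 * star (d k)).im = z.im := by
      simpa [rotation] using congrFun (congrFun (hz'.symm.trans hw) 2) 1
    have hent : ∀ i j, ((Matrix.diagonal d)ᴴ * V.2 * Matrix.diagonal d) i j =
        star (d i) * V.2 i j * d j := by
      intro i j
      rw [Matrix.diagonal_conjTranspose, Matrix.mul_diagonal, Matrix.diagonal_mul, Pi.star_apply]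
    have hdiag : ∀ i, star (d i) * V.2 i i * d i = V.2 i i := by
      intro i
      calc star (d i) * V.2 i i * d i = (star (d i) * d i) * V.2 i i := by ring
        _ = V.2 i i := by rw [hd, one_mul]
    have h0k : star (d 0) * V.2 0 k * d k = star (d 0 * star (d k)) * V.2 0 k := by
      rw [star_mul', star_star]; ring
    simp only [invariantConnection_apply, connValue, hent, hdiag, h0k]
    have hre' : (star (d 0 * star (d k))).re = z.re := hre
    have him' : (star (d 0 * star (d k))).im = -z.im := congrArg Neg.neg him
    rw [hw, rotation_conj_hat z hz, hat_inj, Complex.mul_re, Complex.mul_im, hre', him']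
    refine ⟨rfl, by ring, by ring⟩
  vertical s hs g hg d hd := by
    have h0k : (0 : Fin 3) ≠ k := by rcases hk with rfl | rfl <;> decide
    rw [canonicalConnection_root hk, invariantConnection_apply, connValue, hat_inj]
    simp [Matrix.diagonal_apply_ne _ h0k]

theorem isInvariantForm_invariantConnection (k : Fin 3) (S : Set ℝ) (b φ : ℝ → ℝ) :
    IsInvariantForm k S (fun _ => 0) b (fun _ => 0) φ (invariantConnection k b)
      (fun s _ => hat (φ s) 0 0) :=
  ⟨fun _ _ _ _ _ _ => rfl, fun _ _ _ _ => rfl⟩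

theorem isInvariantIrreducibleMonopole_of_solution {k : Fin 3} (hk : k = 1 ∨ k = 2) {S : Set ℝ}
    (hS : IsOpen S) (hS' : S.OrdConnected) (hne : S.Nonempty) (hpos : S ⊆ Ioi 0) {b φ : ℝ → ℝ}
    (hb : ContDiffOn ℝ ∞ b S) (hφ : ContDiffOn ℝ ∞ φ S)
    (hsol : ∀ s ∈ S, 0 < b s ∧ HasDerivAt b (connRate k s (b s) (φ s)) s ∧
      HasDerivAt φ (higgsRate k s (b s)) s) :
    IsInvariantIrreducibleMonopole (root 0 k) S (invariantConnection k b)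
      (fun s _ => hat (φ s) 0 0) := by
  have hA := isInvariantForm_invariantConnection k S b φ
  refine ⟨hS, hS', hne, hpos, isConnection_invariantConnection hk hb, ⟨smoothOver_hat hφ
    contDiffOn_const contDiffOn_const, fun _ _ _ _ => transpose_hat _ _ _, fun s _ g _ t ht =>
    (weightHom_conj_hat_of_torus hk ht _).symm⟩, fun s hs g hg => ?_,
    fun _ _ _ _ _ _ => ⟨fun _ _ => rfl, rfl⟩,
    isIrreducible_of_invariant hk hS hA (fun s hs => (hsol s hs).1.ne') fun _ _ => rfl⟩
  -- With `q = d = 0` the equation for `d` is trivial, and the other two are those of `connRate` and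
  -- `higgsRate`, since the sign squares to one.
  refine (monopole_iff_of_invariant hk hS hA hs (hpos hs) (hasDerivAt_const s 0) (hsol s hs).2.1
    (hasDerivAt_const s 0) (hsol s hs).2.2 hg).2 ⟨?_, ?_, ?_⟩
  · rw [higgsRate, ← mul_assoc, higgsSign_mul_self]
    ring
  · rw [connRate]; ring
  · ring


/-! ## Gauge inequivalence -/

theorem trace_transpose_mul_self_conj {u B : MatR} (hu : uᵀ * u = 1) :
    Matrix.trace ((u * B * uᵀ)ᵀ * (u * B * uᵀ)) = Matrix.trace (Bᵀ * B) := by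
  have h1 : (u * B * uᵀ)ᵀ * (u * B * uᵀ) = u * (Bᵀ * B * uᵀ) := by
    calc (u * B * uᵀ)ᵀ * (u * B * uᵀ) = u * Bᵀ * (uᵀ * u) * B * uᵀ := by
          simp only [Matrix.transpose_mul, Matrix.transpose_transpose, Matrix.mul_assoc]
      _ = u * (Bᵀ * B * uᵀ) := by rw [hu]; simp only [Matrix.mul_one, Matrix.mul_assoc]
  rw [h1, Matrix.trace_mul_comm, Matrix.mul_assoc, hu, Matrix.mul_one]

/-- The gauge invariants `|Φ|` and `|[A, Φ]|` of invariant pairs. -/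
theorem sq_eq_of_gaugeEquivalent {k : Fin 3} (hk : k = 1 ∨ k = 2) {K : Set ℝ} (hK : IsOpen K)
    {b₁ b₂ φ₁ φ₂ : ℝ → ℝ}
    (h : GaugeEquivalent (root 0 k) K (invariantConnection k b₁) (fun s _ => hat (φ₁ s) 0 0)
      (invariantConnection k b₂) (fun s _ => hat (φ₂ s) 0 0)) {s : ℝ} (hs : s ∈ K) :
    φ₂ s ^ 2 = φ₁ s ^ 2 ∧ (b₂ s * φ₂ s) ^ 2 = (b₁ s * φ₁ s) ^ 2 := by
  obtain ⟨u, hu, h⟩ := h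
  have h0k : (0 : Fin 3) ≠ k := by rcases hk with rfl | rfl <;> decide
  set X := rootVector 0 k 1 with hX
  have hXm : X ∈ su3 := rootVector_mem h0k 1
  have hXv : ∀ b : ℝ → ℝ, invariantConnection k b s 1 (0, X) = hat 0 (b s) 0 := by
    intro b
    rw [invariantConnection_apply, connValue, hat_inj]
    rcases hk with rfl | rfl <;> simp [hX, rootVector]
  have horth : ∀ g ∈ SU3, (u s g)ᵀ * u s g = 1 ∧ u s g * (u s g)ᵀ = 1 := by
    intro g hg
    have := (Matrix.mem_specialOrthogonalGroup_iff.1 (h s hs g hg).1).1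
    exact ⟨(Matrix.mem_orthogonalGroup_iff' _ _).1 this, (Matrix.mem_orthogonalGroup_iff _ _).1 this⟩
  have hcomm : ∀ g ∈ SU3, hat (φ₂ s) 0 0 * u s g - u s g * hat (φ₁ s) 0 0 = 0 := by
    intro g hg
    have h1 := (h s hs g hg).2.2.1
    simp only at h1
    rw [h1, Matrix.mul_assoc, (horth g hg).1, Matrix.mul_one, sub_self]
  obtain ⟨D, hD⟩ := exists_hasDerivAt_of_smoothOver hK hu hs SU3.one_mem
  have hD' := hD (0, X) hXm
  set u' := D (0, 1 * X) with hu'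
  set L : MatR →ₗ[ℝ] MatR :=
    { toFun := fun w => hat (φ₂ s) 0 0 * w - w * hat (φ₁ s) 0 0
      map_add' := fun v w => by simp only [Matrix.mul_add, Matrix.add_mul]; abel
      map_smul' := fun t w => by
        simp only [Matrix.mul_smul, Matrix.smul_mul, RingHom.id_apply, smul_sub] } with hL
  -- The Higgs fields do not depend on `g`, so `u` intertwines them along the whole curve, and its
  -- derivative intertwines them too.
  have hLu : hat (φ₂ s) 0 0 * u' - u' * hat (φ₁ s) 0 0 = 0 := by
    have h1 := L.toContinuousLinearMap.hasFDerivAt.comp_hasDerivAt (0 : ℝ) hD'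
    refine h1.unique ((hasDerivAt_const (0 : ℝ) (0 : MatR)).congr_of_eventuallyEq
      (Filter.Eventually.of_forall fun t => ?_))
    have h2 := hcomm _ (mul_exp_mem_SU3 SU3.one_mem hXm t)
    change hat (φ₂ s) 0 0 * u (s + t * 0) (1 * NormedSpace.exp (t • X))
      - u (s + t * 0) (1 * NormedSpace.exp (t • X)) * hat (φ₁ s) 0 0 = 0
    rwa [mul_zero, add_zero]
  obtain ⟨ho, ho'⟩ := horth 1 SU3.one_mem
  have hΦ := hcomm 1 SU3.one_mem
  have hconn := (h s hs 1 SU3.one_mem).2.2.2 (0, X) hXm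
  rw [hXv, hXv, show dirDeriv u s 1 (0, X) = u' from hD'.deriv] at hconn
  have hΦ' := (h s hs 1 SU3.one_mem).2.2.1
  simp only at hΦ'
  set v := u s 1 with hv
  -- In the commutator with the Higgs field the inhomogeneous term of the gauge action cancels by
  -- `hLu`, so `[A, Φ]` transforms by conjugation.
  have hbr : hat 0 (b₂ s) 0 * hat (φ₂ s) 0 0 - hat (φ₂ s) 0 0 * hat 0 (b₂ s) 0 =
      v * (hat 0 (b₁ s) 0 * hat (φ₁ s) 0 0 - hat (φ₁ s) 0 0 * hat 0 (b₁ s) 0) * vᵀ := by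
    have h1 : hat 0 (b₂ s) 0 * v = v * hat 0 (b₁ s) 0 - u' := by
      rw [hconn, Matrix.sub_mul, Matrix.mul_assoc, ho, Matrix.mul_assoc u', ho, Matrix.mul_one,
        Matrix.mul_one]
    have h2 : (hat 0 (b₂ s) 0 * hat (φ₂ s) 0 0 - hat (φ₂ s) 0 0 * hat 0 (b₂ s) 0) * v =
        v * (hat 0 (b₁ s) 0 * hat (φ₁ s) 0 0 - hat (φ₁ s) 0 0 * hat 0 (b₁ s) 0) := by
      calc _ = hat 0 (b₂ s) 0 * (hat (φ₂ s) 0 0 * v) - hat (φ₂ s) 0 0 * (hat 0 (b₂ s) 0 * v) := by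
            noncomm_ring
        _ = (hat 0 (b₂ s) 0 * v) * hat (φ₁ s) 0 0 - hat (φ₂ s) 0 0 * (hat 0 (b₂ s) 0 * v) := by
            rw [sub_eq_zero.1 hΦ, Matrix.mul_assoc]
        _ = v * hat 0 (b₁ s) 0 * hat (φ₁ s) 0 0 - (hat (φ₂ s) 0 0 * v) * hat 0 (b₁ s) 0
            + (hat (φ₂ s) 0 0 * u' - u' * hat (φ₁ s) 0 0) := by
            rw [h1]; noncomm_ring
        _ = _ := by rw [hLu, sub_eq_zero.1 hΦ]; noncomm_ring
    rw [← h2, Matrix.mul_assoc, ho', Matrix.mul_one]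
  have t1 := trace_transpose_mul_self_conj (B := hat (φ₁ s) 0 0) ho
  rw [← hΦ', trace_transpose_hat_mul_self, trace_transpose_hat_mul_self] at t1
  have t2 := trace_transpose_mul_self_conj
    (B := hat 0 (b₁ s) 0 * hat (φ₁ s) 0 0 - hat (φ₁ s) 0 0 * hat 0 (b₁ s) 0) ho
  rw [← hbr, hat_bracket, hat_bracket, trace_transpose_hat_mul_self,
    trace_transpose_hat_mul_self] at t2
  exact ⟨by nlinarith, by nlinarith⟩

/-- Where `φ₁ ≠ 0` the invariants give `b₁ = b₂` on an open set, and the equation for `b`, divided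
by `b`, then gives `φ₁ = φ₂` with its sign. If such points accumulate at `s₀`, continuity concludes.
Otherwise both Higgs fields vanish near `s₀`, and `φ' = 0` determines `b²`. -/
theorem initial_values_eq_of_gaugeEquivalent {k : Fin 3} (hk : k = 1 ∨ k = 2) {K : Set ℝ}
    (hK : IsOpen K) {b₁ b₂ φ₁ φ₂ : ℝ → ℝ}
    (h₁ : ∀ s ∈ K, 0 < b₁ s ∧ HasDerivAt b₁ (connRate k s (b₁ s) (φ₁ s)) s ∧
      HasDerivAt φ₁ (higgsRate k s (b₁ s)) s)
    (h₂ : ∀ s ∈ K, 0 < b₂ s ∧ HasDerivAt b₂ (connRate k s (b₂ s) (φ₂ s)) s ∧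
      HasDerivAt φ₂ (higgsRate k s (b₂ s)) s)
    (h : GaugeEquivalent (root 0 k) K (invariantConnection k b₁) (fun s _ => hat (φ₁ s) 0 0)
      (invariantConnection k b₂) (fun s _ => hat (φ₂ s) 0 0)) {s₀ : ℝ} (hs₀ : s₀ ∈ K) :
    φ₁ s₀ = φ₂ s₀ ∧ b₁ s₀ = b₂ s₀ := by
  have hinv := fun s hs => sq_eq_of_gaugeEquivalent hk hK h (s := s) hs
  have hσ : higgsSign k ≠ 0 := by unfold higgsSign; split_ifs <;> norm_num
  by_cases hcase : ∀ᶠ s in 𝓝 s₀, φ₁ s = 0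
  · have hcase₂ : ∀ᶠ s in 𝓝 s₀, φ₂ s = 0 := by
      filter_upwards [hcase, hK.mem_nhds hs₀] with s hs hsK
      have := (hinv s hsK).1
      rw [hs] at this
      exact pow_eq_zero_iff two_ne_zero |>.1 (by linarith)
    refine ⟨by rw [hcase.self_of_nhds, hcase₂.self_of_nhds], ?_⟩
    have d₁ := (h₁ s₀ hs₀).2.2.unique ((hasDerivAt_const s₀ (0 : ℝ)).congr_of_eventuallyEq hcase)
    have d₂ := (h₂ s₀ hs₀).2.2.unique ((hasDerivAt_const s₀ (0 : ℝ)).congr_of_eventuallyEq hcase₂)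
    have hF : 0 < profile s₀ ^ 3 := pow_pos (profile_pos s₀) 3
    have e : profile s₀ ^ 3 * b₁ s₀ ^ 2 = profile s₀ ^ 3 * b₂ s₀ ^ 2 := by
      have := mul_left_cancel₀ hσ (d₁.trans d₂.symm)
      linarith
    have := mul_left_cancel₀ hF.ne' e
    exact (pow_left_inj₀ (h₁ s₀ hs₀).1.le (h₂ s₀ hs₀).1.le two_ne_zero).1 this
  · have hb : ∀ s ∈ K, φ₁ s ≠ 0 → b₁ s = b₂ s := by
      intro s hs hne
      obtain ⟨e1, e2⟩ := hinv s hs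
      rw [mul_pow, mul_pow, e1] at e2
      have := mul_right_cancel₀ (pow_ne_zero 2 hne) e2
      exact ((pow_left_inj₀ (h₂ s hs).1.le (h₁ s hs).1.le two_ne_zero).1 this).symm
    have hφ : ∀ s ∈ K, φ₁ s ≠ 0 → φ₁ s = φ₂ s := by
      intro s hs hne
      have hev : ∀ᶠ t in 𝓝 s, b₁ t = b₂ t := by
        filter_upwards [hK.mem_nhds hs, (h₁ s hs).2.2.continuousAt.eventually_ne hne] with t ht ht'
        exact hb t ht ht'
      have e := (h₁ s hs).2.1.unique ((h₂ s hs).2.1.congr_of_eventuallyEq hev)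
      rw [connRate, connRate, hb s hs hne] at e
      have e' := mul_right_cancel₀ (h₂ s hs).1.ne' e
      have hF := (profile_pos s).ne'
      exact mul_left_cancel₀ (mul_ne_zero hσ hF) (by linarith)
    have hfreq : ∃ᶠ s in 𝓝 s₀, φ₁ s = φ₂ s ∧ b₁ s = b₂ s := by
      have h3 : ∃ᶠ s in 𝓝 s₀, φ₁ s ≠ 0 := Filter.not_eventually.1 hcase
      refine (h3.and_eventually (hK.mem_nhds hs₀)).mono ?_
      rintro s ⟨hne, hs⟩
      exact ⟨hφ s hs hne, hb s hs hne⟩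
    constructor
    · by_contra hne
      have h4 : ∀ᶠ s in 𝓝 s₀, φ₁ s ≠ φ₂ s :=
        ((h₁ s₀ hs₀).2.2.continuousAt.prodMk (h₂ s₀ hs₀).2.2.continuousAt).eventually
          ((isOpen_ne_fun continuous_fst continuous_snd).mem_nhds hne)
      exact (hfreq.and_eventually h4).exists.elim fun s hs => hs.2 hs.1.1
    · by_contra hne
      have h4 : ∀ᶠ s in 𝓝 s₀, b₁ s ≠ b₂ s :=
        ((h₁ s₀ hs₀).2.1.continuousAt.prodMk (h₂ s₀ hs₀).2.1.continuousAt).eventually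
          ((isOpen_ne_fun continuous_fst continuous_snd).mem_nhds hne)
      exact (hfreq.and_eventually h4).exists.elim fun s hs => hs.2 hs.1.2


/-! ## Growth near the zero section -/

/-- A function increasing on `(0, u)` is bounded, to the left of `u/2`, by its value at `u/2`.
Comparisons thus run from a fixed point down to zero, at the price of an unspecified constant. -/
theorem eventually_le_of_deriv_nonneg {f : ℝ → ℝ}
    (h : ∀ᶠ s in 𝓝[>] (0 : ℝ), ∃ f', HasDerivAt f f' s ∧ 0 ≤ f') :
    ∃ K, ∀ᶠ s in 𝓝[>] (0 : ℝ), f s ≤ K := by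
  obtain ⟨u, hu, hsub⟩ := mem_nhdsGT_iff_exists_Ioo_subset.1 h
  have hu' : (0 : ℝ) < u := hu
  have hmono : MonotoneOn f (Ioo 0 u) := by
    refine monotoneOn_of_deriv_nonneg (convex_Ioo 0 u) (fun s hs => ?_) (fun s hs => ?_)
      fun s hs => ?_
    · obtain ⟨f', hf, -⟩ := hsub hs
      exact hf.continuousAt.continuousWithinAt
    · rw [interior_Ioo] at hs
      obtain ⟨f', hf, -⟩ := hsub hs
      exact hf.differentiableAt.differentiableWithinAt
    · rw [interior_Ioo] at hs
      obtain ⟨f', hf, hf'⟩ := hsub hs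
      rwa [hf.deriv]
  refine ⟨f (u / 2), ?_⟩
  filter_upwards [Ioo_mem_nhdsGT (show (0 : ℝ) < u / 2 by positivity)] with s hs
  exact hmono ⟨hs.1, by linarith [hs.2]⟩ ⟨by positivity, by linarith⟩ hs.2.le

/-- Comparison for functions with derivative bounded below. -/
theorem eventually_le_sub_of_le_deriv {ψ H h : ℝ → ℝ}
    (hψ : ∀ᶠ s in 𝓝[>] (0 : ℝ), ∃ ψ', HasDerivAt ψ ψ' s ∧ h s ≤ ψ')
    (hH : ∀ᶠ s in 𝓝[>] (0 : ℝ), HasDerivAt H (-h s) s) :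
    ∃ K, ∀ᶠ s in 𝓝[>] (0 : ℝ), ψ s ≤ K - H s := by
  obtain ⟨K, hK⟩ := eventually_le_of_deriv_nonneg (f := fun s => ψ s + H s) (by
    filter_upwards [hψ, hH] with s ⟨ψ', h1, h2⟩ h3
    exact ⟨_, h1.add h3, by linarith⟩)
  refine ⟨K, ?_⟩
  filter_upwards [hK] with s hs
  linarith

/-- Comparison for the logarithm of a solution of `W' = 2 F ψ W` with `F ≥ 1 / 2`. -/
theorem eventually_sub_le_log {F ψ W G g : ℝ → ℝ} (hF : ∀ᶠ s in 𝓝[>] (0 : ℝ), 1 / 2 ≤ F s)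
    (hW : ∀ᶠ s in 𝓝[>] (0 : ℝ), 0 < W s ∧ HasDerivAt W (2 * F s * ψ s * W s) s)
    (hψ : ∀ᶠ s in 𝓝[>] (0 : ℝ), 0 ≤ g s ∧ ψ s ≤ -g s)
    (hG : ∀ᶠ s in 𝓝[>] (0 : ℝ), HasDerivAt G (-g s) s) :
    ∃ K, ∀ᶠ s in 𝓝[>] (0 : ℝ), G s - K ≤ Real.log (W s) := by
  obtain ⟨K, hK⟩ := eventually_le_of_deriv_nonneg (f := fun s => G s - Real.log (W s)) (by
    filter_upwards [hF, hW, hψ, hG] with s h1 h2 h3 h4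
    refine ⟨_, h4.sub (h2.2.log h2.1.ne'), ?_⟩
    rw [mul_div_assoc, div_self h2.1.ne', mul_one]
    nlinarith [h3.1, h3.2])
  refine ⟨K, ?_⟩
  filter_upwards [hK] with s hs
  linarith

theorem eventually_inv_ge (K : ℝ) : ∀ᶠ s in 𝓝[>] (0 : ℝ), K ≤ s⁻¹ :=
  tendsto_inv_nhdsGT_zero.eventually_ge_atTop K

theorem eventually_pos_nhdsGT : ∀ᶠ s in 𝓝[>] (0 : ℝ), 0 < s := eventually_mem_nhdsWithin

theorem hasDerivAt_mul_inv_pow (c : ℝ) (n : ℕ) {s : ℝ} (hs : 0 < s) :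
    HasDerivAt (fun s : ℝ => c * s⁻¹ ^ n) (-(c * n * s⁻¹ ^ (n + 1))) s := by
  have h := ((hasDerivAt_inv hs.ne').pow n).const_mul c
  refine h.congr_deriv ?_
  rcases n with _ | n
  · simp
  · simp only [Nat.add_sub_cancel]
    rw [← inv_pow]
    ring

/-- The differential inequalities for invariant monopoles force growth like `exp (1 / s²)`. -/
theorem eventually_le_sub_exp {F ψ W : ℝ → ℝ} (hF : ∀ᶠ s in 𝓝[>] (0 : ℝ), 1 / 2 ≤ F s)
    (hψ : ∀ᶠ s in 𝓝[>] (0 : ℝ), ∃ ψ', HasDerivAt ψ ψ' s ∧ (8 + W s) / 32 * s⁻¹ ^ 2 ≤ ψ')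
    (hW : ∀ᶠ s in 𝓝[>] (0 : ℝ), 0 < W s ∧ HasDerivAt W (2 * F s * ψ s * W s) s) :
    ∃ K, ∀ᶠ s in 𝓝[>] (0 : ℝ), ψ s ≤ K - Real.exp (s⁻¹ ^ 2) := by
  -- a bound `W ≥ 32 M - 8` gives `log W ≥ - (M / 2) log s - K`
  have step : ∀ M : ℝ, 0 < M → (∀ᶠ s in 𝓝[>] (0 : ℝ), 32 * M ≤ 8 + W s) →
      ∃ K, ∀ᶠ s in 𝓝[>] (0 : ℝ), -(M / 2 * Real.log s) - K ≤ Real.log (W s) := by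
    intro M hM hWM
    obtain ⟨K, hK⟩ := eventually_le_sub_of_le_deriv (ψ := ψ) (H := fun s => M * s⁻¹ ^ 1)
      (h := fun s => M * (1 : ℕ) * s⁻¹ ^ (1 + 1)) (by
        filter_upwards [hψ, hWM] with s ⟨ψ', h1, h2⟩ h3
        refine ⟨ψ', h1, le_trans ?_ h2⟩
        have : (0 : ℝ) ≤ s⁻¹ ^ 2 := by positivity
        norm_num only [Nat.cast_one]
        nlinarith) (by
        filter_upwards [eventually_pos_nhdsGT] with s hs
        exact hasDerivAt_mul_inv_pow M 1 hs)
    refine eventually_sub_le_log (G := fun s => -(M / 2 * Real.log s)) (g := fun s => M / 2 * s⁻¹)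
      hF hW ?_ ?_
    · filter_upwards [hK, eventually_pos_nhdsGT, eventually_inv_ge (2 * K / M)] with s h1 h2 h3
      refine ⟨by positivity, ?_⟩
      rw [div_le_iff₀ hM] at h3
      rw [pow_one] at h1
      linarith
    · filter_upwards [eventually_pos_nhdsGT] with s hs
      exact ((Real.hasDerivAt_log hs.ne').const_mul (M / 2)).neg
  -- The start of the feedback: `W > 0` alone permits `M = 1/4`, and the resulting growth like
  -- `s^(-1/8)` is enough for `W` to become large.
  obtain ⟨K₁, hK₁⟩ := step (1 / 4) (by norm_num) (by
    filter_upwards [hW] with s hs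
    linarith [hs.1])
  have hlog : ∀ C : ℝ, ∀ᶠ s in 𝓝[>] (0 : ℝ), C ≤ -Real.log s := fun C =>
    (tendsto_neg_atBot_atTop.comp Real.tendsto_log_nhdsGT_zero).eventually_ge_atTop C
  -- `M = 8` requires `W ≥ 248`, which follows from `W ≥ 256`. It yields growth like `s⁻⁴`, one
  -- power more than the `512 s⁻³` used next.
  obtain ⟨K₂, hK₂⟩ := step 8 (by norm_num) (by
    filter_upwards [hW, hK₁, hlog (8 * (K₁ + Real.log 256))] with s h1 h2 h3
    have : Real.log 256 ≤ Real.log (W s) := by linarith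
    have := (Real.log_le_log_iff (by norm_num) h1.1).1 this
    linarith)
  have hW₃ : ∀ᶠ s in 𝓝[>] (0 : ℝ), 512 * s⁻¹ ^ 3 ≤ W s := by
    filter_upwards [hW, hK₂, hlog (K₂ + Real.log 512), eventually_pos_nhdsGT] with s h1 h2 h3 h4
    refine (Real.log_le_log_iff (by positivity) h1.1).1 ?_
    rw [Real.log_mul (by norm_num) (by positivity), Real.log_pow, Real.log_inv]
    push_cast
    linarith
  obtain ⟨K₃, hK₃⟩ := eventually_le_sub_of_le_deriv (ψ := ψ) (H := fun s => 4 * s⁻¹ ^ 4)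
    (h := fun s => 4 * (4 : ℕ) * s⁻¹ ^ (4 + 1)) (by
      filter_upwards [hψ, hW₃] with s ⟨ψ', h1, h2⟩ h3
      refine ⟨ψ', h1, le_trans ?_ h2⟩
      have : (0 : ℝ) ≤ s⁻¹ ^ 2 := by positivity
      push_cast
      calc 4 * 4 * s⁻¹ ^ (4 + 1) = (512 * s⁻¹ ^ 3) / 32 * s⁻¹ ^ 2 := by ring
        _ ≤ _ := by gcongr; linarith) (by
      filter_upwards [eventually_pos_nhdsGT] with s hs
      exact hasDerivAt_mul_inv_pow 4 4 hs)
  -- From `ψ ≤ K₃ - 4 s⁻⁴`, one multiple of `s⁻⁴` is spent on absorbing `K₃`. The remaining `-3 s⁻⁴`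
  -- is the derivative of `s⁻³`, so `W` exceeds a multiple of `exp (s⁻³)`.
  obtain ⟨K₄, hK₄⟩ := eventually_sub_le_log (G := fun s => 1 * s⁻¹ ^ 3)
    (g := fun s => 1 * (3 : ℕ) * s⁻¹ ^ (3 + 1)) hF hW (by
      filter_upwards [hK₃, eventually_pos_nhdsGT, eventually_inv_ge K₃, eventually_inv_ge 1]
        with s h1 h2 h3 h4
      refine ⟨by positivity, h1.trans ?_⟩
      have : s⁻¹ ≤ s⁻¹ ^ 4 := le_self_pow₀ h4 (by norm_num)
      push_cast
      linarith) (by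
      filter_upwards [eventually_pos_nhdsGT] with s hs
      exact hasDerivAt_mul_inv_pow 1 3 hs)
  refine eventually_le_sub_of_le_deriv (H := fun s => Real.exp (s⁻¹ ^ 2))
    (h := fun s => 2 * s⁻¹ ^ 3 * Real.exp (s⁻¹ ^ 2)) ?_ ?_
  · filter_upwards [hψ, hW, hK₄, eventually_pos_nhdsGT, eventually_inv_ge 3,
      eventually_inv_ge (K₄ + Real.log 64)] with s ⟨ψ', h1, h2⟩ h3 h4 h5 h6 h7
    refine ⟨ψ', h1, le_trans ?_ h2⟩
    have hinv : 0 < s⁻¹ := inv_pos.2 h5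
    -- The exponent `s⁻³` dominates `s⁻²` and the logarithm of the prefactor. The factor `64 s⁻¹` is
    -- what the derivative of `exp (s⁻²)` requires after division of `W` by `32 s²`.
    have hmain : 64 * s⁻¹ * Real.exp (s⁻¹ ^ 2) ≤ W s := by
      refine (Real.log_le_log_iff (by positivity) h3.1).1 ?_
      rw [Real.log_mul (by positivity) (by positivity), Real.log_mul (by norm_num) hinv.ne',
        Real.log_exp]
      have e1 : Real.log s⁻¹ ≤ s⁻¹ := (Real.log_le_sub_one_of_pos hinv).trans (by linarith)
      have e2 : s⁻¹ ^ 2 + 2 * s⁻¹ ≤ s⁻¹ ^ 3 := by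
        have : 0 ≤ s⁻¹ * ((s⁻¹ - 3) * (s⁻¹ + 2) + 4) := by
          have : 0 ≤ (s⁻¹ - 3) * (s⁻¹ + 2) := mul_nonneg (by linarith) (by linarith)
          positivity
        nlinarith
      linarith
    calc 2 * s⁻¹ ^ 3 * Real.exp (s⁻¹ ^ 2) = (64 * s⁻¹ * Real.exp (s⁻¹ ^ 2)) / 32 * s⁻¹ ^ 2 := by ring
      _ ≤ _ := by gcongr; linarith
  · filter_upwards [eventually_pos_nhdsGT] with s hs
    have h := (hasDerivAt_mul_inv_pow 1 2 hs).exp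
    simp only [one_mul] at h
    refine h.congr_deriv ?_
    push_cast
    ring

/-- The product of `W` with the integrating factor `exp (-∫ a)` is constant on the interval. -/
theorem ne_zero_of_linear_ode {S : Set ℝ} (hS : IsOpen S) (hS' : S.OrdConnected) {a W : ℝ → ℝ}
    (ha : ContinuousOn a S) (hW : ∀ s ∈ S, HasDerivAt W (a s * W s) s) {s₁ : ℝ} (hs₁ : s₁ ∈ S)
    (h : W s₁ ≠ 0) : ∀ s ∈ S, W s ≠ 0 := by
  have hP : ∀ s ∈ S, HasDerivAt (fun s => ∫ t in s₁..s, a t) (a s) s := fun s hs =>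
    intervalIntegral.integral_hasDerivAt_right
      ((ha.mono (hS'.uIcc_subset hs₁ hs)).intervalIntegrable)
      (ha.stronglyMeasurableAtFilter hS s hs) (ha.continuousAt (hS.mem_nhds hs))
  have hd : ∀ s ∈ S, HasDerivAt (fun s => W s * Real.exp (-∫ t in s₁..s, a t)) 0 s := by
    intro s hs
    refine ((hW s hs).mul (hP s hs).neg.exp).congr_deriv ?_
    ring
  intro s hs h0
  have := hS.is_const_of_deriv_eq_zero hS'.isPreconnected
    (fun s hs => (hd s hs).differentiableAt.differentiableWithinAt)
    (fun s hs => (hd s hs).deriv) hs hs₁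
  simp [h0] at this
  exact h this.symm


/-! ### Growth of the Higgs field of an invariant irreducible monopole -/

theorem hasDerivAt_of_contDiffOn {S : Set ℝ} (hS : IsOpen S) {f : ℝ → ℝ} (hf : ContDiffOn ℝ ∞ f S)
    {s : ℝ} (hs : s ∈ S) : HasDerivAt f (deriv f s) s :=
  ((hf.contDiffAt (hS.mem_nhds hs)).differentiableAt (by simp)).hasDerivAt

theorem eventually_half_le_profile : ∀ᶠ s in 𝓝[>] (0 : ℝ), ∀ t ∈ Icc 0 s, 1 / 2 ≤ profile t := by
  filter_upwards [Ioo_mem_nhdsGT (show (0 : ℝ) < 1 by norm_num)] with s hs t ht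
  have := inv_le_profile (a := 2) (s := t) (by norm_num) (by nlinarith [hs.2, ht.1, ht.2])
  rwa [one_div]

theorem soNorm_hat (a : ℝ) : soNorm (hat a 0 0) = |a| := by
  rw [soNorm, trace_transpose_hat_mul_self, ← Real.sqrt_sq_eq_abs]
  congr 1
  ring

/-- The Higgs field of an invariant irreducible monopole on a punctured neighbourhood of the zero
section grows at least like `exp (1 / s²)`. -/
theorem exists_exp_le_higgs {k : Fin 3} (hk : k = 1 ∨ k = 2) {S : Set ℝ} {A : OneForm}
    {Φ : ℝ → Mat → MatR} (hM : IsInvariantIrreducibleMonopole (root 0 k) S A Φ) {σ : ℝ}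
    (hσ : 0 < σ) (hσS : Ioo 0 σ ⊆ S) :
    ∃ K, ∀ᶠ s in 𝓝[>] (0 : ℝ), ∀ g ∈ SU3, Real.exp (s⁻¹ ^ 2) - K ≤ soNorm (Φ s g) := by
  obtain ⟨q, b, d, φ, hq, hb, hd, hφ, hA⟩ :=
    exists_isInvariantForm hk hM.connection hM.higgs hM.invariant
  set e := higgsSign k with he
  have hee : e * e = 1 := higgsSign_mul_self k
  have hode : ∀ s ∈ S, _ := fun s hs =>
    (monopole_iff_of_invariant hk hM.isOpen hA hs (hM.pos hs)
      (hasDerivAt_of_contDiffOn hM.isOpen hq hs) (hasDerivAt_of_contDiffOn hM.isOpen hb hs)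
      (hasDerivAt_of_contDiffOn hM.isOpen hd hs) (hasDerivAt_of_contDiffOn hM.isOpen hφ hs)
      SU3.one_mem).1 (hM.monopole s hs 1 SU3.one_mem)
  -- The factor `s²` absorbs the `-1/s` of the equations for `b` and `d`, and the sum of squares
  -- removes `q`, which only rotates `(b, d)`.
  set W : ℝ → ℝ := fun s => s ^ 2 * (b s ^ 2 + d s ^ 2) with hW
  have hWder : ∀ s ∈ S, HasDerivAt W (2 * profile s * (e * φ s) * W s) s := by
    intro s hs
    obtain ⟨-, h2, h3⟩ := hode s hs
    have hs0 : s ≠ 0 := (hM.pos hs).ne'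
    have h := ((hasDerivAt_id s).pow 2).mul
      (((hasDerivAt_of_contDiffOn hM.isOpen hb hs).pow 2).add
        ((hasDerivAt_of_contDiffOn hM.isOpen hd hs).pow 2))
    refine h.congr_deriv ?_
    rw [h2, h3]
    simp only [id, hW]
    field_simp
    norm_num
    ring
  obtain ⟨s₁, hs₁, hne⟩ := exists_ne_zero_of_irreducible hk hM.isOpen hM.nonempty hA hM.irreducible
  have hWne : ∀ s ∈ S, W s ≠ 0 := by
    refine ne_zero_of_linear_ode hM.isOpen hM.ordConnected ?_ hWder hs₁
      (mul_ne_zero (pow_ne_zero 2 (hM.pos hs₁).ne') hne)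
    exact (continuousOn_const.mul continuous_profile.continuousOn).mul
      (continuousOn_const.mul hφ.continuousOn)
  have hWpos : ∀ s ∈ S, 0 < W s := fun s hs =>
    lt_of_le_of_ne (by simp only [hW]; positivity) (hWne s hs).symm
  have hSev : ∀ᶠ s in 𝓝[>] (0 : ℝ), s ∈ S :=
    Filter.mem_of_superset (Ioo_mem_nhdsGT hσ) hσS
  obtain ⟨K, hK⟩ := eventually_le_sub_exp (F := profile) (ψ := fun s => e * φ s) (W := W) (by
      filter_upwards [eventually_half_le_profile, eventually_pos_nhdsGT] with s h1 h2
      exact h1 s ⟨h2.le, le_rfl⟩) (by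
      filter_upwards [hSev, eventually_half_le_profile, eventually_pos_nhdsGT,
        eventually_inv_ge 2] with s hs h1 h2 h3
      refine ⟨_, (hasDerivAt_of_contDiffOn hM.isOpen hφ hs).const_mul e, ?_⟩
      rw [(hode s hs).1]
      have hF1 := h1 s ⟨h2.le, le_rfl⟩
      have hF2 := profile_le_one s
      have hF := profile_pos s
      -- With `1/2 ≤ F ≤ 1` and `s ≤ 1/2`: the positive term is at least `s⁻²/2`, the negative one
      -- at most `1/2 ≤ s⁻²/8`, and `F³ ≥ 1/8` makes the coefficient of `b² + d²` at least `1/32`.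
      have e1 : s⁻¹ ^ 2 / 2 ≤ 1 / (2 * s ^ 2 * profile s) := by
        rw [inv_pow, le_div_iff₀ (by positivity)]
        field_simp
        exact hF2
      have e2 : profile s ^ 3 ≤ 1 := pow_le_one₀ hF.le hF2
      have e3 : 1 / 8 ≤ profile s ^ 3 := by
        have := pow_le_pow_left₀ (by norm_num) hF1 3
        norm_num at this ⊢
        linarith
      have e4 : W s * s⁻¹ ^ 2 = b s ^ 2 + d s ^ 2 := by
        simp only [hW]
        field_simp
      have e5 : 4 ≤ s⁻¹ ^ 2 := by nlinarith
      have e6 : 0 ≤ b s ^ 2 + d s ^ 2 := by positivity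
      have e7 : (8 + W s) / 32 * s⁻¹ ^ 2 = s⁻¹ ^ 2 / 4 + (b s ^ 2 + d s ^ 2) / 32 := by
        rw [← e4]; ring
      rw [e7]
      nlinarith [mul_le_mul_of_nonneg_right e3 e6]) (by
      filter_upwards [hSev] with s hs
      exact ⟨hWpos s hs, hWder s hs⟩)
  refine ⟨K, ?_⟩
  filter_upwards [hK, hSev] with s h1 hs g hg
  rw [hA.higgs s hs g hg, soNorm_hat]
  have h2 : |φ s| = |e * φ s| := by
    have : |e| = 1 := by
      have := abs_mul_abs_self e
      rw [hee] at this
      nlinarith [abs_nonneg e]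
    rw [abs_mul, this, one_mul]
  rw [h2]
  linarith [neg_abs_le (e * φ s)]

/-! ### Growth in terms of the geodesic distance -/

theorem eventually_radius_bounds :
    ∀ᶠ s in 𝓝[>] (0 : ℝ), 1 / 2 * s ≤ radius s ∧ radius s ≤ s := by
  filter_upwards [eventually_half_le_profile, eventually_pos_nhdsGT] with s h1 h2
  exact ⟨mul_le_radius h2.le h1, radius_le h2.le⟩

theorem eventually_lt_exp_mul_of_exp_le {n : ℝ → ℝ} {K : ℝ}
    (h : ∀ᶠ s in 𝓝[>] (0 : ℝ), Real.exp (s⁻¹ ^ 2) - K ≤ n s) (C : ℝ) :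
    ∀ᶠ s in 𝓝[>] (0 : ℝ), C < Real.exp (-(1 / 8) / radius s ^ 2) * n s := by
  filter_upwards [h, eventually_radius_bounds, eventually_pos_nhdsGT, eventually_inv_ge 1,
    eventually_inv_ge (2 * (|K| + |C|))] with s h1 h2 h3 h4 h5
  have hr : 0 < radius s := by linarith [h2.1]
  have hx : s⁻¹ ≤ s⁻¹ ^ 2 := le_self_pow₀ h4 (by norm_num)
  -- As `r ≥ s/2`, the weight with `δ = 1/8` costs at most half of the exponent `s⁻²`, and `exp
  -- (s⁻²/2)` is still unbounded.
  have h6 : -(s⁻¹ ^ 2 / 2) ≤ -(1 / 8) / radius s ^ 2 := by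
    rw [neg_div, neg_le_neg_iff, div_le_iff₀ (by positivity), inv_pow]
    have : 1 / 4 * s ^ 2 ≤ radius s ^ 2 := by nlinarith [h2.1]
    have h7 : (s ^ 2)⁻¹ / 2 * (1 / 4 * s ^ 2) = 1 / 8 := by field_simp; norm_num
    rw [← h7]
    gcongr
  have h7 : Real.exp (-(1 / 8) / radius s ^ 2) ≤ 1 := by
    rw [Real.exp_le_one_iff]
    exact div_nonpos_of_nonpos_of_nonneg (by norm_num) (by positivity)
  have h8 : Real.exp (s⁻¹ ^ 2 / 2) ≤
      Real.exp (-(1 / 8) / radius s ^ 2) * Real.exp (s⁻¹ ^ 2) := by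
    rw [← Real.exp_add]
    exact Real.exp_le_exp.2 (by linarith)
  have h9 := Real.add_one_le_exp (s⁻¹ ^ 2 / 2)
  have h10 : Real.exp (-(1 / 8) / radius s ^ 2) * K ≤ |K| := by
    calc _ ≤ Real.exp (-(1 / 8) / radius s ^ 2) * |K| := by gcongr; exact le_abs_self K
      _ ≤ 1 * |K| := by gcongr
      _ = |K| := one_mul _
  have h11 := mul_le_mul_of_nonneg_left h1 (Real.exp_pos (-(1 / 8) / radius s ^ 2)).le
  rw [mul_sub] at h11
  linarith [le_abs_self C]

/-- The bound `exp x ≥ 1 + x` suffices: growth like `s⁻²` times `r ≥ s/2` already diverges like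
`1/(2s)`. -/
theorem tendsto_radius_mul_of_exp_le {n : ℝ → ℝ} {K : ℝ}
    (h : ∀ᶠ s in 𝓝[>] (0 : ℝ), Real.exp (s⁻¹ ^ 2) - K ≤ n s) :
    Tendsto (fun s => radius s * n s) (𝓝[>] 0) atTop := by
  refine tendsto_atTop.2 fun C => ?_
  filter_upwards [h, eventually_radius_bounds, eventually_pos_nhdsGT,
    eventually_inv_ge (2 * (|K| + |C|)), eventually_inv_ge 1] with s h1 h2 h3 h4 h5
  have h6 := Real.add_one_le_exp (s⁻¹ ^ 2)
  have hs1 : s ≤ 1 := by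
    have := inv_le_one_of_one_le₀ h5
    rwa [inv_inv] at this
  have h7 : s⁻¹ ^ 2 - |K| ≤ n s := by linarith [le_abs_self K]
  have hx : s⁻¹ ≤ s⁻¹ ^ 2 := le_self_pow₀ h5 (by norm_num)
  have h8 : 0 ≤ s⁻¹ ^ 2 - |K| := by linarith [abs_nonneg K, abs_nonneg C]
  have h9 : 1 / 2 * s * (s⁻¹ ^ 2 - |K|) ≤ radius s * n s :=
    mul_le_mul h2.1 h7 h8 (by linarith [h2.1])
  have h10 : 1 / 2 * s * (s⁻¹ ^ 2 - |K|) = s⁻¹ / 2 - 1 / 2 * s * |K| := by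
    field_simp
  have h11 : s * |K| ≤ |K| := mul_le_of_le_one_left (abs_nonneg K) hs1
  linarith [le_abs_self C, abs_nonneg K]

end BryantSalamon

/-- `P_{α₁}` is the case `k = 1` and `P_{α₃}` the case `k = 2`. -/
theorem theorem2 (k : Fin 3) (hk : k = 1 ∨ k = 2) :
    (∀ ε : ℝ, 0 < ε → ∃ s₀ : ℝ, 0 < s₀ ∧ radius s₀ = ε ∧
      ∃ (S : ℝ → ℝ → Set ℝ) (A : ℝ → ℝ → OneForm) (Φ : ℝ → ℝ → ℝ → Mat → MatR),
        (∀ x y : ℝ, 0 < y →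
          s₀ ∈ S x y ∧
          IsInvariantIrreducibleMonopole (root 0 k) (S x y) (A x y) (Φ x y) ∧
          ∀ g ∈ SU3, Φ x y s₀ g = x • L₁ ∧
            ∀ V : Tan, V.2 ∈ su3 →
              A x y s₀ g V = canonicalConnection (root 0 k) V.2 + y • rootMorphism 0 k V.2) ∧
        (∀ x y x' y' : ℝ, 0 < y → 0 < y' → (x, y) ≠ (x', y') →
          ∀ K : Set ℝ, IsOpen K → s₀ ∈ K → K ⊆ S x y → K ⊆ S x' y' →
            ¬ GaugeEquivalent (root 0 k) K (A x y) (Φ x y) (A x' y') (Φ x' y'))) ∧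
    (∀ (S : Set ℝ) (A : OneForm) (Φ : ℝ → Mat → MatR),
      IsInvariantIrreducibleMonopole (root 0 k) S A Φ →
      ∀ σ : ℝ, 0 < σ → Ioo 0 σ ⊆ S →
        (∃ δ : ℝ, 0 < δ ∧ ∀ s₁ ∈ Ioc 0 σ, ∀ C : ℝ, ∃ s ∈ Ioo 0 s₁, ∃ g ∈ SU3,
          C < Real.exp (-δ / radius s ^ 2) * soNorm (Φ s g)) ∧
        ∀ g ∈ SU3, ∀ c : ℝ,
          ¬ Tendsto (fun s => radius s * soNorm (Φ s g)) (𝓝[>] 0) (𝓝 c)) := by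
  refine ⟨fun ε hε => ?_, fun S A Φ hM σ hσ hσS => ?_⟩
  · obtain ⟨s₀, hs₀, hr₀⟩ := exists_radius_eq hε
    refine ⟨s₀, hs₀, hr₀, ?_⟩
    choose! r b φ hr hpos hb hφ hb₀ hφ₀ hsol using
      fun (x y : ℝ) (hy : 0 < y) => exists_local_solution k hs₀ x hy
    have hmem : ∀ x y, 0 < y → s₀ ∈ Ioo (s₀ - r x y) (s₀ + r x y) := fun x y hy =>
      ⟨by linarith [hr x y hy], by linarith [hr x y hy]⟩
    refine ⟨fun x y => Ioo (s₀ - r x y) (s₀ + r x y), fun x y => invariantConnection k (b x y),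
      fun x y s _ => hat (φ x y s) 0 0, fun x y hy => ⟨hmem x y hy, ?_, fun g hg => ⟨?_, ?_⟩⟩, ?_⟩
    · exact isInvariantIrreducibleMonopole_of_solution hk isOpen_Ioo ordConnected_Ioo
        ⟨s₀, hmem x y hy⟩ (hpos x y hy) (hb x y hy) (hφ x y hy) (hsol x y hy)
    · simp [hat_eq, hφ₀ x y hy]
    · intro V hV
      rw [invariantConnection_apply, connValue, hb₀ x y hy, canonicalConnection_root hk,
        rootMorphism_eq, smul_hat, hat_add, hat_inj]
      simp
    -- Only the values at `s₀` are compared: the gauge equivalence over any neighbourhood `K` of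
    -- `s₀` forces the initial data to agree.
    · intro x y x' y' hy hy' hne K hK hs₀K hKS hKS' hgauge
      obtain ⟨h1, h2⟩ := initial_values_eq_of_gaugeEquivalent hk hK
        (fun s hs => hsol x y hy s (hKS hs)) (fun s hs => hsol x' y' hy' s (hKS' hs)) hgauge hs₀K
      rw [hφ₀ x y hy, hφ₀ x' y' hy'] at h1
      rw [hb₀ x y hy, hb₀ x' y' hy'] at h2
      exact hne (by rw [h1, h2])
  · obtain ⟨K, hK⟩ := exists_exp_le_higgs hk hM hσ hσS
    have hg : ∀ g ∈ SU3, ∀ᶠ s in 𝓝[>] (0 : ℝ), Real.exp (s⁻¹ ^ 2) - K ≤ soNorm (Φ s g) :=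
      fun g hg => hK.mono fun s hs => hs g hg
    refine ⟨⟨1 / 8, by norm_num, fun s₁ hs₁ C => ?_⟩, fun g hgm c hc => ?_⟩
    · obtain ⟨s, hs, hs'⟩ := ((eventually_lt_exp_mul_of_exp_le (hg 1 SU3.one_mem) C).and
        (Ioo_mem_nhdsGT hs₁.1)).exists
      exact ⟨s, hs', 1, SU3.one_mem, hs⟩
    · exact not_tendsto_nhds_of_tendsto_atTop (tendsto_radius_mul_of_exp_le (hg g hgm)) c hc
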